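/- Let $\mathbf A$ be a finite algebra (with an arbitrary set of finitary basic operations on a finite universe $A$) that is finitely related, that is, there is a relational structure $\mathbb A$ on the universe $A$ with finite signature such that for every $n\ge 1$ the $n$-ary term operations of $\mathbf A$ are exactly the $n$-ary polymorphisms of $\mathbb A$ (the operations $A^n\to A$ preserving all relations of $\mathbb A$). Let $B\subseteq A$ be a subuniverse of $\mathbf A$. Then the following are equivalent. (a) $B$ is an absorbing subuniverse of $\mathbf A$: there are $n\ge 1$ and an $n$-ary term $t$ of $\mathbf A$ that is idempotent, i.e. $t(a,\dots,a)=a$ for all $a\in A$, such that $t(B,\dots,B,A,B,\dots,B)\subseteq B$ for each of the $n$ positions of $A$. (b) $B$ is a Jónsson absorbing subuniverse of $\mathbf A$: there are $n\ge 0$ and ternary terms $d_0,\dots,d_n$ of $\mathbf A$ such that $d_i(B,A,B)\subseteq B$ for all $i\le n$, $d_i(x,y,y)=d_{i+1}(x,x,y)$ for all $i<n$ and all $x,y\in A$, and $d_0(x,y,z)=x$ and $d_n(x,y,z)=z$ for all $x,y,z\in A$. -/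

import Mathlib

universe u v w

namespace FirstOrder.Language

/-- `f` is the `n`-ary term operation of the algebra `A` induced by some term in `n` variables. -/
def IsTermOperation (L : Language.{u, v}) {A : Type w} [L.Structure A] {n : ℕ}
    (f : (Fin n → A) → A) : Prop :=
  ∃ t : L.Term (Fin n), ∀ x : Fin n → A, t.realize x = f x

/-- `f` is an `n`-ary polymorphism of the relational structure `A`: applying `f` coordinatewise
to `n` tuples of a relation yields again a tuple of that relation. -/
def IsPolymorphism (R : Language.{u, v}) {A : Type w} [R.Structure A] {n : ℕ}
    (f : (Fin n → A) → A) : Prop :=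
  ∀ (k : ℕ) (r : R.Relations k) (m : Fin n → Fin k → A),
    (∀ j, Structure.RelMap r (m j)) → Structure.RelMap r (fun i => f (fun j => m j i))

/-- The algebra `A` is finitely related: there is a relational structure with finite signature on
the same universe whose polymorphisms are exactly the term operations of `A`. As usual for clones,
only operations of positive arity are considered. -/
def IsFinitelyRelated (L : Language.{u, v}) (A : Type w) [L.Structure A] : Prop :=
  ∃ (R : Language.{0, 0}) (_ : R.IsRelational) (_ : Finite (Σ k, R.Relations k))
    (_ : R.Structure A),
    ∀ (n : ℕ), 1 ≤ n → ∀ f : (Fin n → A) → A, L.IsTermOperation f ↔ R.IsPolymorphism f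

namespace Substructure

variable {L : Language.{u, v}} {A : Type w} [L.Structure A]

/-- The subuniverse `B` absorbs `A`: there is an idempotent term `t`, of some positive arity, with
`t(B, …, B, A, B, …, B) ⊆ B` for every position of `A`. -/
def IsAbsorbing (B : L.Substructure A) : Prop :=
  ∃ (n : ℕ) (_ : 1 ≤ n) (t : L.Term (Fin n)),
    (∀ a : A, t.realize (fun _ => a) = a) ∧
    ∀ (i : Fin n) (x : Fin n → A), (∀ j, j ≠ i → x j ∈ B) → t.realize x ∈ B

/-- The subuniverse `B` Jónsson absorbs `A`: there is a sequence `d₀, …, dₙ` of ternary terms with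
`dᵢ(B, A, B) ⊆ B` for `i ≤ n`, `dᵢ(x, y, y) ≈ dᵢ₊₁(x, x, y)` for `i < n`, `d₀(x, y, z) ≈ x` and
`dₙ(x, y, z) ≈ z`. -/
def IsJonssonAbsorbing (B : L.Substructure A) : Prop :=
  ∃ (n : ℕ) (d : Fin (n + 1) → L.Term (Fin 3)),
    (∀ (i : Fin (n + 1)) (b a b' : A), b ∈ B → b' ∈ B → (d i).realize ![b, a, b'] ∈ B) ∧
    (∀ (i : Fin n) (x y : A),
      (d i.castSucc).realize ![x, y, y] = (d i.succ).realize ![x, x, y]) ∧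
    (∀ x y z : A, (d 0).realize ![x, y, z] = x) ∧
    (∀ x y z : A, (d (Fin.last n)).realize ![x, y, z] = z)

end Substructure

end FirstOrder.Language

/-! From an absorbing `N`-ary term a Jónsson chain arises by putting `x`, `y`, `z` into consecutive
blocks of variables, at most one variable receiving `y`, and moving the boundary one variable at a
time.

Conversely, let `k` bound the arities of the relations. An operation that agrees on any `k` points
with some term operation is a polymorphism, hence a term operation. So it suffices to find, for some
`N`, an operation on `A^N` that absorbs `B` and agrees locally with idempotent terms. This is a
constraint problem: values are sought for all tuples of points of `A^N`, any two values must come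
from one idempotent term, and values in `B` are prescribed at points with at most one coordinate
outside `B`. For large `N`, a bounded number of prescriptions is met by a projection to a coordinate
exceptional for none of the points. `exists_pairwise_selection` passes from boundedly many
prescriptions to all of them; its bound does not depend on the index set, so `N` may be chosen
afterwards.

That passage has two halves. If arc consistency failed, some tree formula with fewest constraints
would be unsatisfiable; a large one contains a long chain of relations, each of which can be relaxed
to make the chain satisfiable, and Ramsey's theorem with the Jónsson chain then satisfies it
outright (`exists_arc_consistent`). Applied to triples of coordinates, this gives a path-consistent
network, which is shrunk to a minimal absorbing reduction (`exists_minimal_reduction`). By the loop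
lemma `exists_loop`, polynomials acting on all coordinates at once collapse every set of the
reduction to a point, and these points are pairwise compatible. -/

/-! ### Jónsson chains, walks and the loop lemma -/

/-- A Jónsson chain of ternary operations, extended by the third projection. -/
structure IsJonssonChain {Ω : Type*} (n : ℕ) (d : ℕ → Ω → Ω → Ω → Ω) : Prop where
  first : ∀ x y z, d 0 x y z = x
  last : ∀ t, n ≤ t → ∀ x y z, d t x y z = z
  step : ∀ t x y, d t x y y = d (t + 1) x x y

namespace IsJonssonChain

variable {Ω : Type*} {n : ℕ} {d : ℕ → Ω → Ω → Ω → Ω}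

theorem idem (h : IsJonssonChain n d) (t : ℕ) (x : Ω) : d t x x x = x := by
  induction t with
  | zero => exact h.first _ _ _
  | succ t ih => rw [← h.step, ih]

theorem mono (h : IsJonssonChain n d) {m : ℕ} (hm : n ≤ m) : IsJonssonChain m d :=
  ⟨h.first, fun t ht => h.last t (hm.trans ht), h.step⟩

theorem pi (h : IsJonssonChain n d) (I : Type*) :
    IsJonssonChain n (fun t (x y z : I → Ω) i => d t (x i) (y i) (z i)) :=
  ⟨fun _ _ _ => funext fun _ => h.first _ _ _,
    fun t ht _ _ _ => funext fun _ => h.last t ht _ _ _,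
    fun _ _ _ => funext fun _ => h.step _ _ _⟩

theorem prod (h : IsJonssonChain n d) {Ω' : Type*} {d' : ℕ → Ω' → Ω' → Ω' → Ω'}
    (h' : IsJonssonChain n d') :
    IsJonssonChain n (fun t (x y z : Ω × Ω') => (d t x.1 y.1 z.1, d' t x.2 y.2 z.2)) :=
  ⟨fun x y z => by simp [h.first, h'.first],
    fun t ht x y z => by simp [h.last t ht, h'.last t ht],
    fun t x y => by simp [h.step, h'.step]⟩

/-- Two `V`-walks with `U`-links from the first to the second merge into one: `d t` sends the pair
of `t`-th steps and the link to a step ending in `d t (u (t+1)) (w (t+1)) (w (t+1))`, which the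
chain identity rewrites as the next vertex. -/
theorem exists_path (h : IsJonssonChain n d) (V U : ℕ → Ω → Ω → Prop) (u w : ℕ → Ω)
    (hu : ∀ t < n, V t (u t) (u (t + 1))) (hw : ∀ t < n, V t (w t) (w (t + 1)))
    (hc : ∀ t < n, U t (u t) (w (t + 1)))
    (hV : ∀ t < n, ∀ s a a' b b' c c', V t a a' → U t b b' → V t c c' →
      V t (d s a b c) (d s a' b' c')) :
    ∃ x : ℕ → Ω, x 0 = u 0 ∧ x n = w n ∧ ∀ t < n, V t (x t) (x (t + 1)) := by
  refine ⟨fun t => d t (u t) (u t) (w t), h.first _ _ _, h.last n le_rfl _ _ _, fun t ht => ?_⟩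
  have := hV t ht t _ _ _ _ _ _ (hu t ht) (hc t ht) (hw t ht)
  rwa [h.step] at this

end IsJonssonChain

theorem exists_periodic_walk {Ω : Type*} [Finite Ω] (V : Ω → Ω → Prop) (C : Set Ω)
    (hC : C.Nonempty) (hp : ∀ c ∈ C, ∃ b ∈ C, V b c) :
    ∃ (u : ℕ → Ω) (m : ℕ), 0 < m ∧ (∀ t, u t ∈ C) ∧ (∀ t, V (u t) (u (t + 1))) ∧
      ∀ t, u (t + m) = u t := by
  classical
  obtain ⟨c₀, hc₀⟩ := hC
  choose! p hpC hpV using hp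
  have hit : ∀ i, ∀ c ∈ C, p^[i] c ∈ C := fun i => by
    induction i with
    | zero => exact fun c hc => hc
    | succ i ih => exact fun c hc => ih _ (hpC c hc)
  obtain ⟨i, j, hij, he⟩ :
      ∃ i j, i < j ∧ p^[i] c₀ = p^[j] c₀ := by
    obtain ⟨i, j, hij, he⟩ := Finite.exists_ne_map_eq_of_infinite (fun i : ℕ => p^[i] c₀)
    rcases lt_or_gt_of_ne hij with h | h
    · exact ⟨i, j, h, he⟩
    · exact ⟨j, i, h, he.symm⟩
  obtain ⟨m, rfl⟩ : ∃ m, j = i + (m + 1) := ⟨j - i - 1, by omega⟩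
  set x := p^[i] c₀
  have hx : p^[m + 1] x = x := by
    rw [add_comm, Function.iterate_add_apply] at he
    exact he.symm
  have hper : ∀ k, p^[k + (m + 1)] x = p^[k] x := fun k => by
    rw [Function.iterate_add_apply, hx]
  have hper' : ∀ l k, p^[k + (m + 1) * l] x = p^[k] x := fun l => by
    induction l with
    | zero => simp
    | succ l ih => intro k; rw [Nat.mul_succ, ← add_assoc, hper, ih]
  -- The map `p` picks predecessors and has period `m + 1` at `x`. As `m` is `-1` modulo `m + 1`,
  -- the exponent `m * t` runs the cycle backwards, that is, along `V`.
  refine ⟨fun t => p^[m * t] x, m + 1, Nat.succ_pos _, fun t => hit _ _ (hit _ _ hc₀), fun t => ?_,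
    fun t => ?_⟩
  · have := hpV (p^[m * (t + 1)] x) (hit _ _ (hit _ _ hc₀))
    rw [← Function.iterate_succ_apply' p] at this
    have h2 := hper (m * t)
    rw [show m * t + (m + 1) = (m * (t + 1)).succ by rw [Nat.mul_succ]; omega] at h2
    rwa [h2] at this
  · show p^[m * (t + (m + 1))] x = _
    rw [Nat.mul_add, mul_comm m (m + 1), hper']

/-- Walks of prescribed length of a binary relation. -/
def RelWalk {Ω : Type*} (V : Ω → Ω → Prop) : ℕ → Ω → Ω → Prop
  | 0, a, b => a = b
  | l + 1, a, c => ∃ b, RelWalk V l a b ∧ V b c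

namespace RelWalk

variable {Ω : Type*} {V : Ω → Ω → Prop}

theorem of_seq {u : ℕ → Ω} {l : ℕ} (hu : ∀ t < l, V (u t) (u (t + 1))) :
    RelWalk V l (u 0) (u l) := by
  induction l with
  | zero => rfl
  | succ l ih => exact ⟨u l, ih fun t ht => hu t (by omega), hu l (by omega)⟩

theorem trans {l m : ℕ} {a b c : Ω} (h : RelWalk V l a b) (h' : RelWalk V m b c) :
    RelWalk V (l + m) a c := by
  induction m generalizing c with
  | zero => cases h'; exact h
  | succ m ih => obtain ⟨e, he, hec⟩ := h'; exact ⟨e, ih he, hec⟩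

theorem mul {l : ℕ} {a : Ω} (h : RelWalk V l a a) (m : ℕ) : RelWalk V (l * m) a a := by
  induction m with
  | zero => rfl
  | succ m ih => exact ih.trans h

theorem closed {U : Ω → Ω → Prop} {d : Ω → Ω → Ω → Ω}
    (hV : ∀ a a' b b' c c', V a a' → U b b' → V c c' → V (d a b c) (d a' b' c'))
    {l : ℕ} {a a' b b' c c' : Ω} (h₁ : RelWalk V l a a') (h₂ : RelWalk U l b b')
    (h₃ : RelWalk V l c c') : RelWalk V l (d a b c) (d a' b' c') := by
  induction l generalizing a' b' c' with
  | zero => cases h₁; cases h₂; cases h₃; rfl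
  | succ l ih =>
    obtain ⟨e₁, h₁, g₁⟩ := h₁
    obtain ⟨e₂, h₂, g₂⟩ := h₂
    obtain ⟨e₃, h₃, g₃⟩ := h₃
    exact ⟨_, ih h₁ h₂ h₃, hV _ _ _ _ _ _ g₁ g₂ g₃⟩

end RelWalk

/-- Induction on the size of `D`. A proper closed subset with predecessors inside itself carries a
smaller instance. If there is none, closed walks of two consecutive lengths make the sets reachable
in exactly `i` steps grow to all of `D`, and the first `i` where this happens must be `0`. -/
theorem exists_loop {Ω : Type*} [Finite Ω] {n : ℕ} {d : ℕ → Ω → Ω → Ω → Ω}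
    (h : IsJonssonChain n d) (D : Set Ω) (V : Ω → Ω → Prop) (hne : D.Nonempty)
    (hsub : ∀ a b, V a b → a ∈ D ∧ b ∈ D) (hsucc : ∀ a ∈ D, ∃ b, V a b)
    (hpred : ∀ a ∈ D, ∃ b, V b a)
    (hV : ∀ s a a' b b' c c', V a a' → V b b' → V c c' → V (d s a b c) (d s a' b' c'))
    (hV' : ∀ s a a' c c', ∀ b ∈ D, V a a' → V c c' → V (d s a b c) (d s a' b c')) :
    ∃ c, V c c := by
  induction hcard : D.ncard using Nat.strong_induction_on generalizing D V with
  | _ N IH =>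
  by_cases hC : ∃ C ⊆ D, C ≠ D ∧ C.Nonempty ∧ (∀ s, ∀ a ∈ C, ∀ b ∈ C, ∀ c ∈ C, d s a b c ∈ C) ∧
      ∀ c ∈ C, ∃ b ∈ C, V b c
  · obtain ⟨C, hCD, hne', hCne, hCcl, hCp⟩ := hC
    -- Keeping only the starts of infinite walks inside `C` restores successors and does not destroy
    -- predecessors.
    let C' : Set Ω := {c | ∃ u : ℕ → Ω, u 0 = c ∧ ∀ t, u t ∈ C ∧ V (u t) (u (t + 1))}
    have hC'C : C' ⊆ C := by
      rintro c ⟨u, rfl, hu⟩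
      exact (hu 0).1
    have hlt : C'.ncard < N := by
      rw [← hcard]
      exact Set.ncard_lt_ncard (lt_of_le_of_lt hC'C (lt_of_le_of_ne hCD hne')) (Set.toFinite _)
    have hcons : ∀ b c, c ∈ C' → b ∈ C → V b c → b ∈ C' := by
      rintro b c ⟨u, rfl, hu⟩ hb hbc
      refine ⟨fun t => Nat.casesOn t b u, rfl, fun t => ?_⟩
      cases t with
      | zero => exact ⟨hb, hbc⟩
      | succ t => exact hu t
    have hC'cl : ∀ s, ∀ a ∈ C', ∀ b ∈ C', ∀ c ∈ C', d s a b c ∈ C' := by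
      rintro s a ⟨u, rfl, hu⟩ b ⟨v, rfl, hv⟩ c ⟨w, rfl, hw⟩
      exact ⟨fun t => d s (u t) (v t) (w t), rfl, fun t =>
        ⟨hCcl _ _ (hu t).1 _ (hv t).1 _ (hw t).1, hV _ _ _ _ _ _ _ (hu t).2 (hv t).2 (hw t).2⟩⟩
    suffices ∃ c, c ∈ C' ∧ c ∈ C' ∧ V c c from this.imp fun c hc => hc.2.2
    refine IH _ hlt C' (fun a b => a ∈ C' ∧ b ∈ C' ∧ V a b) ?_
      (fun a b hab => ⟨hab.1, hab.2.1⟩) ?_ ?_ ?_ ?_ rfl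
    · obtain ⟨u, m, -, huC, huV, -⟩ := exists_periodic_walk V C hCne hCp
      exact ⟨u 0, u, rfl, fun t => ⟨huC t, huV t⟩⟩
    · rintro a ⟨u, rfl, hu⟩
      exact ⟨u 1, ⟨u, rfl, hu⟩, ⟨fun t => u (t + 1), rfl, fun t => hu (t + 1)⟩, (hu 0).2⟩
    · intro a ha
      obtain ⟨b, hb, hba⟩ := hCp a (hC'C ha)
      exact ⟨b, hcons b a ha hb hba, ha, hba⟩
    · rintro s a a' b b' c c' ⟨ha, ha', h₁⟩ ⟨hb, hb', h₂⟩ ⟨hc, hc', h₃⟩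
      exact ⟨hC'cl _ _ ha _ hb _ hc, hC'cl _ _ ha' _ hb' _ hc', hV _ _ _ _ _ _ _ h₁ h₂ h₃⟩
    · rintro s a a' c c' b hb ⟨ha, ha', h₁⟩ ⟨hc, hc', h₃⟩
      exact ⟨hC'cl _ _ ha _ hb _ hc, hC'cl _ _ ha' _ hb _ hc',
        hV' _ _ _ _ _ _ (hCD (hC'C hb)) h₁ h₃⟩
  · push Not at hC
    have hmin : ∀ C ⊆ D, C.Nonempty → (∀ s, ∀ a ∈ C, ∀ b ∈ C, ∀ c ∈ C, d s a b c ∈ C) →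
        (∀ c ∈ C, ∃ b ∈ C, V b c) → C = D := by
      intro C h1 h2 h3 h4
      by_contra h5
      obtain ⟨c, hc, hc'⟩ := hC C h1 h5 h2 h3
      obtain ⟨b, hb, hbc⟩ := h4 c hc
      exact hc' b hb hbc
    obtain ⟨u, m, hm, huD, huV, hum⟩ := exists_periodic_walk V D hne fun c hc => by
      obtain ⟨b, hb⟩ := hpred c hc
      exact ⟨b, (hsub _ _ hb).1, hb⟩
    have hum' : ∀ l, u (m * l) = u 0 := fun l => by
      induction l with
      | zero => rfl
      | succ l ih => rw [Nat.mul_succ, hum, ih]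
    let q := m * (n + 1)
    have hq : 0 < q := Nat.mul_pos hm (Nat.succ_pos _)
    have hw₁ : RelWalk V q (u 0) (u 0) := by
      have := RelWalk.of_seq (V := V) (u := u) (l := q) fun t _ => huV t
      rwa [hum'] at this
    -- The periodic walk is merged with its shift by `m - 1`. Since `u t = u (t + m)`, the links are
    -- equalities, which `V` absorbs, and the new walk has length one more than a multiple of `m`.
    have hw₂ : RelWalk V (q + 1) (u 0) (u 0) := by
      have hn : n ≤ q + 1 := by
        have : 1 * (n + 1) ≤ q := Nat.mul_le_mul_right _ hm
        omega
      obtain ⟨x, hx0, hx1, hx⟩ := (h.mono hn).exists_path (fun _ => V)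
        (fun _ a b => a = b ∧ a ∈ D) u (fun t => u (t + (m - 1))) (fun t _ => huV t)
        (fun t _ => by
          have := huV (t + (m - 1))
          rwa [show t + (m - 1) + 1 = t + 1 + (m - 1) by omega] at this)
        (fun t _ => ⟨by rw [show t + 1 + (m - 1) = t + m by omega, hum], huD t⟩)
        (by
          rintro t - s a a' b _ c c' h₁ ⟨rfl, hb⟩ h₃
          exact hV' _ _ _ _ _ _ hb h₁ h₃)
      have := RelWalk.of_seq hx
      rwa [hx0, hx1, show q + 1 + (m - 1) = m * (n + 1) + m by omega, hum, hum'] at this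
    have hall : ∀ l, q * q ≤ l → RelWalk V l (u 0) (u 0) := by
      intro l hl
      have h1 : l % q < q := Nat.mod_lt _ hq
      have h2 : q ≤ l / q := (Nat.le_div_iff_mul_le hq).2 hl
      have h3 := (hw₁.mul (l / q - l % q)).trans (hw₂.mul (l % q))
      have h4 : q * (l / q - l % q) + (q + 1) * (l % q) = l := by
        obtain ⟨e, he⟩ : ∃ e, l / q = l % q + e := ⟨l / q - l % q, by omega⟩
        have h5 := Nat.div_add_mod l q
        rw [he] at h5 ⊢
        rw [Nat.add_sub_cancel_left]
        linarith
      rwa [h4] at h3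
    let S : ℕ → Set Ω := fun i => {b | RelWalk V i (u 0) b}
    have hSD : ∀ i, S i ⊆ D := by
      intro i b hb
      cases i with
      | zero => cases hb; exact huD 0
      | succ i => obtain ⟨c, -, hc⟩ := hb; exact (hsub _ _ hc).2
    have hScl : ∀ i s, ∀ a ∈ S i, ∀ b ∈ S i, ∀ c ∈ S i, d s a b c ∈ S i := by
      intro i s a ha b hb c hc
      have := RelWalk.closed (hV s) ha hb hc
      rwa [h.idem] at this
    have hSmono : ∀ i l, q * q ≤ l → S i ⊆ S (i + l) := by
      intro i l hl b hb
      have := (hall l hl).trans hb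
      rwa [add_comm] at this
    -- A set `S i` of maximal size equals all sufficiently late ones, so its elements have
    -- predecessors in it and minimality applies.
    have hfull : ∃ i, S i = D := by
      obtain ⟨i, hi⟩ : ∃ i, ∀ j, (S j).ncard ≤ (S i).ncard := by
        have hfin : (Set.range fun j => (S j).ncard).Finite :=
          (Set.finite_Iic D.ncard).subset (by
            rintro _ ⟨j, rfl⟩
            exact Set.ncard_le_ncard (hSD j) (Set.toFinite _))
        obtain ⟨_, ⟨i, rfl⟩, hi⟩ := Set.exists_max_image _ id hfin (Set.range_nonempty _)
        exact ⟨i, fun j => hi _ ⟨j, rfl⟩⟩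
      have he : ∀ l, q * q ≤ l → S i = S (i + l) := fun l hl =>
        Set.eq_of_subset_of_ncard_le (hSmono i l hl) (hi _) (Set.toFinite _)
      have hne' : (S i).Nonempty := by
        rw [he (q * q + i * (q - 1)) (by omega)]
        refine ⟨u 0, ?_⟩
        apply hall
        omega
      refine ⟨i, hmin _ (hSD i) hne' (hScl i) fun c hc => ?_⟩
      rw [he (q * q + 1) (by omega)] at hc
      obtain ⟨b, hb, hbc⟩ := hc
      exact ⟨b, by rw [he (q * q) le_rfl]; exact hb, hbc⟩
    classical
    obtain ⟨hi, hmin'⟩ := And.intro (Nat.find_spec hfull) fun j => Nat.find_min hfull (m := j)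
    generalize Nat.find hfull = i at hi hmin'
    cases i with
    | zero =>
      obtain ⟨b, hb⟩ := hsucc (u 0) (huD 0)
      have hb' : b ∈ S 0 := hi ▸ (hsub _ _ hb).2
      have : u 0 = b := hb'
      subst this
      exact ⟨_, hb⟩
    | succ i =>
      refine absurd (hmin (S i) (hSD i) ?_ (hScl i) fun c hc => ?_) (hmin' i (Nat.lt_succ_self i))
      · have := huD 0
        rw [← hi] at this
        obtain ⟨b, hb, -⟩ := this
        exact ⟨b, hb⟩
      · have := hSD i hc
        rw [← hi] at this
        exact this

/-! ### Ramsey's theorem for pairs -/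

/-- The colour of a pair is made to depend on its smaller element only: take the minimum, keep a
majority colour class of the rest, and recurse. -/
theorem exists_endHomogeneous (K : Type*) [Finite K] (m : ℕ) :
    ∃ N, ∀ (col : ℕ → ℕ → K) (S : Finset ℕ), N ≤ S.card →
      ∃ H ⊆ S, H.card = m ∧ ∃ κ : ℕ → K, ∀ i ∈ H, ∀ j ∈ H, i < j → col i j = κ i := by
  classical
  have := Fintype.ofFinite K
  induction m with
  | zero =>
    exact ⟨0, fun col S _ => ⟨∅, by simp, rfl, fun i => col i i, by simp⟩⟩
  | succ m ih =>
    obtain ⟨N, hN⟩ := ih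
    refine ⟨Fintype.card K * N + 1, fun col S hS => ?_⟩
    have hne : S.Nonempty := Finset.card_pos.1 (by omega)
    set a := S.min' hne
    have ha : a ∈ S := S.min'_mem hne
    have : Nonempty K := ⟨col a a⟩
    obtain ⟨κ₀, -, hκ₀⟩ := Finset.exists_le_card_fiber_of_mul_le_card_of_maps_to
      (s := S.erase a) (t := Finset.univ) (f := col a) (n := N) (fun _ _ => Finset.mem_univ _)
      Finset.univ_nonempty (by rw [Finset.card_erase_of_mem ha, Finset.card_univ]; omega)
    obtain ⟨H, hHS, hHm, κ, hκ⟩ := hN col _ hκ₀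
    have hH : ∀ j ∈ H, a < j ∧ j ∈ S ∧ col a j = κ₀ := fun j hj => by
      have := hHS hj
      rw [Finset.mem_filter, Finset.mem_erase] at this
      exact ⟨lt_of_le_of_ne (S.min'_le _ this.1.2) (Ne.symm this.1.1), this.1.2, this.2⟩
    refine ⟨insert a H, ?_, ?_, Function.update κ a κ₀, ?_⟩
    · exact Finset.insert_subset ha fun j hj => (hH j hj).2.1
    · rw [Finset.card_insert_of_notMem fun h => lt_irrefl _ (hH a h).1, hHm]
    · intro i hi j hj hij
      rw [Finset.mem_insert] at hi hj
      rcases hi with rfl | hi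
      · rcases hj with rfl | hj
        · exact absurd hij (lt_irrefl _)
        · rw [Function.update_self, (hH j hj).2.2]
      · rw [Function.update_of_ne (hH i hi).1.ne']
        rcases hj with rfl | hj
        · exact absurd (hH i hi).1 hij.asymm
        · exact hκ i hi j hj hij

/-- Finite Ramsey theorem for pairs. -/
theorem exists_homogeneous (K : Type*) [Finite K] (r : ℕ) :
    ∃ N, ∀ col : ℕ → ℕ → K, ∃ (τ : ℕ → ℕ) (κ : K), (∀ i < r, τ i < N) ∧
      (∀ i j, i < j → j < r → τ i < τ j) ∧ ∀ i j, i < j → j < r → col (τ i) (τ j) = κ := by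
  classical
  have := Fintype.ofFinite K
  obtain ⟨N, hN⟩ := exists_endHomogeneous K (Fintype.card K * r)
  refine ⟨N, fun col => ?_⟩
  have : Nonempty K := ⟨col 0 0⟩
  obtain ⟨H, hHS, hHm, κ, hκ⟩ := hN col (Finset.range N) (Finset.card_range N).ge
  obtain ⟨κ₀, -, hκ₀⟩ := Finset.exists_le_card_fiber_of_mul_le_card_of_maps_to
    (s := H) (t := Finset.univ) (f := κ) (n := r) (fun _ _ => Finset.mem_univ _)
    Finset.univ_nonempty (by rw [hHm, Finset.card_univ])
  obtain ⟨H', hH', hr⟩ := Finset.exists_subset_card_eq hκ₀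
  have hmem : ∀ i (hi : i < r), H'.orderEmbOfFin hr ⟨i, hi⟩ ∈ H ∧
      κ (H'.orderEmbOfFin hr ⟨i, hi⟩) = κ₀ := fun i hi =>
    Finset.mem_filter.1 (hH' (H'.orderEmbOfFin_mem hr ⟨i, hi⟩))
  have hlt : ∀ i j (hj : j < r) (hij : i < j),
      H'.orderEmbOfFin hr ⟨i, hij.trans hj⟩ < H'.orderEmbOfFin hr ⟨j, hj⟩ := fun i j hj hij =>
    (H'.orderEmbOfFin hr).strictMono hij
  refine ⟨fun i => if hi : i < r then H'.orderEmbOfFin hr ⟨i, hi⟩ else 0, κ₀, ?_, ?_, ?_⟩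
  · intro i hi
    simp only [hi, dif_pos]
    exact Finset.mem_range.1 (hHS (hmem i hi).1)
  · intro i j hij hj
    simp only [hj, hij.trans hj, dif_pos]
    exact hlt i j hj hij
  · intro i j hij hj
    simp only [hj, hij.trans hj, dif_pos]
    rw [hκ _ (hmem i _).1 _ (hmem j hj).1 (hlt i j hj hij), (hmem i _).2]

/-! ### Critical chains of relations -/

/-- `P` is the set of sources of a chain of `T` relations `V t` ending in some set; each `V t` is
absorbed in some larger relation `U t`, and replacing any one `V t` by `U t` makes the chain
reachable from `X`. -/
def HasCriticalChain {Ω : Type*} (d : ℕ → Ω → Ω → Ω → Ω) (T : ℕ) (P : Ω → Prop) (X : Set Ω) :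
    Prop :=
  ∃ (V U : ℕ → Ω → Ω → Prop) (Y : Set Ω),
    (∀ t a b, V t a b → U t a b) ∧
    (∀ t s a a' b b' c c', V t a a' → U t b b' → V t c c' → V t (d s a b c) (d s a' b' c')) ∧
    (∀ a, P a ↔ ∃ σ : ℕ → Ω, σ 0 = a ∧ (∀ t < T, V t (σ t) (σ (t + 1))) ∧ σ T ∈ Y) ∧
    ∀ τ < T, ∃ σ : ℕ → Ω, σ 0 ∈ X ∧ (∀ t < T, t ≠ τ → V t (σ t) (σ (t + 1))) ∧
      U τ (σ τ) (σ (τ + 1)) ∧ σ T ∈ Y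

namespace HasCriticalChain

variable {Ω : Type*} {d : ℕ → Ω → Ω → Ω → Ω} {T : ℕ} {P : Ω → Prop} {X : Set Ω}

theorem zero : HasCriticalChain d 0 P X :=
  ⟨fun _ _ _ => True, fun _ _ _ => True, {a | P a}, by simp, by simp,
    fun a => ⟨fun h => ⟨fun _ => a, rfl, by simp, h⟩, by rintro ⟨σ, rfl, -, h⟩; exact h⟩, by simp⟩

theorem congr {P' : Ω → Prop} (h : HasCriticalChain d T P X) (hP : ∀ a, P a ↔ P' a) :
    HasCriticalChain d T P' X := by
  rwa [← show P = P' from funext fun a => propext (hP a)]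

/-- `R` is absorbed into the first link, so the length does not change. -/
theorem comp {R : Ω → Ω → Prop}
    (hR : ∀ s a a' b b' c c', R a a' → R b b' → R c c' → R (d s a b c) (d s a' b' c'))
    (h : HasCriticalChain d T P {b | ∃ a ∈ X, R a b}) :
    HasCriticalChain d T (fun a => ∃ b, R a b ∧ P b) X := by
  cases T with
  | zero => exact zero
  | succ T =>
  obtain ⟨V, U, Y, hVU, hV, hP, hX⟩ := h
  refine ⟨fun t => Nat.casesOn t (fun a c => ∃ b, R a b ∧ V 0 b c) (fun t => V (t + 1)),
    fun t => Nat.casesOn t (fun a c => ∃ b, R a b ∧ U 0 b c) (fun t => U (t + 1)), Y, ?_, ?_, ?_, ?_⟩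
  · rintro (_ | t) a b
    · rintro ⟨c, h₁, h₂⟩
      exact ⟨c, h₁, hVU _ _ _ h₂⟩
    · exact hVU _ _ _
  · rintro (_ | t)
    · rintro s a a' b b' c c' ⟨x, h₁, h₁'⟩ ⟨y, h₂, h₂'⟩ ⟨z, h₃, h₃'⟩
      exact ⟨_, hR _ _ _ _ _ _ _ h₁ h₂ h₃, hV _ _ _ _ _ _ _ _ h₁' h₂' h₃'⟩
    · exact hV _
  · intro a
    constructor
    · rintro ⟨b, hab, hb⟩
      obtain ⟨σ, rfl, hσ, hY⟩ := (hP b).1 hb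
      refine ⟨fun t => Nat.casesOn t a fun t => σ (t + 1), rfl, ?_, hY⟩
      rintro (_ | t) ht
      · exact ⟨_, hab, hσ 0 ht⟩
      · exact hσ _ ht
    · rintro ⟨σ, rfl, hσ, hY⟩
      obtain ⟨b, hab, hb⟩ := hσ 0 (Nat.succ_pos T)
      refine ⟨b, hab, (hP b).2 ⟨fun t => Nat.casesOn t b fun t => σ (t + 1), rfl, ?_, hY⟩⟩
      rintro (_ | t) ht
      · exact hb
      · exact hσ _ ht
  · intro τ hτ
    obtain ⟨σ, ⟨a, ha, hab⟩, hσ, hU, hY⟩ := hX τ hτ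
    refine ⟨fun t => Nat.casesOn t a fun t => σ (t + 1), ha, ?_, ?_, hY⟩
    · rintro (_ | t) ht hne
      · exact ⟨_, hab, hσ 0 ht hne⟩
      · exact hσ _ ht hne
    · cases τ with
      | zero => exact ⟨_, hab, hU⟩
      | succ τ => exact hU

theorem restrict {Q : Ω → Prop} (hQ : ∀ s a b c, Q a → Q b → Q c → Q (d s a b c))
    (h : HasCriticalChain d T P {a | a ∈ X ∧ Q a}) :
    HasCriticalChain d T (fun a => Q a ∧ P a) X := by
  have : {a | a ∈ X ∧ Q a} = {b | ∃ a ∈ X, a = b ∧ Q a} := by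
    ext b
    exact ⟨fun hb => ⟨b, hb.1, rfl, hb.2⟩, by rintro ⟨a, ha, rfl, hb⟩; exact ⟨ha, hb⟩⟩
  rw [this] at h
  refine (comp (R := fun a b => a = b ∧ Q a) ?_ h).congr fun a => ?_
  · rintro s a _ b _ c _ ⟨rfl, h₁⟩ ⟨rfl, h₂⟩ ⟨rfl, h₃⟩
    exact ⟨rfl, hQ _ _ _ _ h₁ h₂ h₃⟩
  · exact ⟨by rintro ⟨b, ⟨rfl, h₁⟩, h₂⟩; exact ⟨h₁, h₂⟩, fun h => ⟨a, ⟨rfl, h.1⟩, h.2⟩⟩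

/-- The new first link is equality restricted to `Q`, relaxed to equality restricted to `Q'`. -/
theorem cons {Q Q' : Ω → Prop} (hQQ : ∀ a, Q a → Q' a)
    (hQ : ∀ s a b c, Q a → Q' b → Q c → Q (d s a b c))
    (h : HasCriticalChain d T P {a | a ∈ X ∧ Q a}) (hX : ∃ a ∈ X, Q' a ∧ P a) :
    HasCriticalChain d (T + 1) (fun a => Q a ∧ P a) X := by
  obtain ⟨V, U, Y, hVU, hV, hP, hX'⟩ := h
  refine ⟨fun t => Nat.casesOn t (fun a b => a = b ∧ Q a) V,
    fun t => Nat.casesOn t (fun a b => a = b ∧ Q' a) U, Y, ?_, ?_, ?_, ?_⟩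
  · rintro (_ | t) a b
    · exact fun h => ⟨h.1, hQQ _ h.2⟩
    · exact hVU _ _ _
  · rintro (_ | t)
    · rintro s a _ b _ c _ ⟨rfl, h₁⟩ ⟨rfl, h₂⟩ ⟨rfl, h₃⟩
      exact ⟨rfl, hQ _ _ _ _ h₁ h₂ h₃⟩
    · exact hV _
  · intro a
    constructor
    · rintro ⟨hq, hp⟩
      obtain ⟨σ, rfl, hσ, hY⟩ := (hP a).1 hp
      refine ⟨fun t => Nat.casesOn t (σ 0) σ, rfl, ?_, hY⟩
      rintro (_ | t) ht
      · exact ⟨rfl, hq⟩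
      · exact hσ t (Nat.lt_of_succ_lt_succ ht)
    · rintro ⟨σ, rfl, hσ, hY⟩
      obtain ⟨h₁, h₂⟩ : σ 0 = σ 1 ∧ Q (σ 0) := hσ 0 (Nat.succ_pos T)
      exact ⟨h₂, (hP _).2 ⟨fun t => σ (t + 1), h₁.symm, fun t ht => hσ (t + 1) (by omega), hY⟩⟩
  · rintro (_ | τ) hτ
    · obtain ⟨a, ha, hq, hp⟩ := hX
      obtain ⟨σ, rfl, hσ, hY⟩ := (hP a).1 hp
      refine ⟨fun t => Nat.casesOn t (σ 0) σ, ha, ?_, ⟨rfl, hq⟩, hY⟩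
      rintro (_ | t) ht hne
      · exact absurd rfl hne
      · exact hσ t (Nat.lt_of_succ_lt_succ ht)
    · obtain ⟨σ, ha, hσ, hU, hY⟩ := hX' τ (Nat.lt_of_succ_lt_succ hτ)
      refine ⟨fun t => Nat.casesOn t (σ 0) σ, ha.1, ?_, hU, hY⟩
      rintro (_ | t) ht hne
      · exact ⟨rfl, ha.2⟩
      · exact hσ t (Nat.lt_of_succ_lt_succ ht) fun h => hne (h ▸ rfl)

end HasCriticalChain

theorem exists_seq_glue {Ω : Type*} {V : ℕ → Ω → Ω → Prop} {X : Set Ω} {p q : ℕ} (hpq : p ≤ q)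
    {σ ρ : ℕ → Ω} (hX : σ 0 ∈ X) (hσ : ∀ t < p, V t (σ t) (σ (t + 1)))
    (hρ : ∀ t, p ≤ t → t < q → V t (ρ t) (ρ (t + 1))) (h : σ p = ρ p) :
    ∃ π : ℕ → Ω, π 0 ∈ X ∧ (∀ t < q, V t (π t) (π (t + 1))) ∧ π q = ρ q := by
  refine ⟨fun t => if t ≤ p then σ t else ρ t, by simpa using hX, fun t ht => ?_, ?_⟩
  · rcases lt_trichotomy t p with h' | rfl | h'
    · simpa [h'.le, Nat.succ_le_of_lt h'] using hσ t h'
    · simpa [h] using hρ t le_rfl ht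
    · simpa [h'.not_ge, (h'.trans (Nat.lt_succ_self t)).not_ge] using hρ t h'.le ht
  · rcases hpq.lt_or_eq with h' | rfl
    · simp [h'.not_ge]
    · simpa using h

theorem HasCriticalChain.exists_mem (Ω : Type*) [Finite Ω] [Nonempty Ω] (n : ℕ) :
    ∃ T, ∀ d : ℕ → Ω → Ω → Ω → Ω, IsJonssonChain n d → ∀ (P : Ω → Prop) (X : Set Ω),
      HasCriticalChain d T P X → ∃ a ∈ X, P a := by
  obtain ⟨T, hT⟩ := exists_homogeneous (Ω × Ω) (2 * n + 3)
  refine ⟨T, fun d h P X => ?_⟩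
  rintro ⟨V, U, Y, hVU, hV, hP, hX⟩
  choose! σ hσX hσV hσU hσY using hX
  -- Here `σ i` is a realization defective only at link `i`. On the homogeneous positions, it passes
  -- through `c` before its defect and through `z` after it.
  obtain ⟨τ, ⟨z, c⟩, hτT, hτ, hcol⟩ := hT fun i j => (σ i j, σ j i)
  have hτ' : ∀ i j, i ≤ j → j < 2 * n + 3 → τ i ≤ τ j := fun i j hij hj => by
    rcases hij.lt_or_eq with h | rfl
    · exact (hτ i j h hj).le
    · exact le_rfl
  have hz : ∀ i j, i < j → j < 2 * n + 3 → σ (τ i) (τ j) = z := fun i j hij hj =>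
    congrArg Prod.fst (hcol i j hij hj)
  have hc : ∀ i j, i < j → j < 2 * n + 3 → σ (τ j) (τ i) = c := fun i j hij hj =>
    congrArg Prod.snd (hcol i j hij hj)
  have hVall : ∀ i < 2 * n + 3, ∀ t < T, t ≠ τ i → V t (σ (τ i) t) (σ (τ i) (t + 1)) :=
    fun i hi => hσV _ (hτT i hi)
  have hUall : ∀ i < 2 * n + 3, ∀ t < T, U t (σ (τ i) t) (σ (τ i) (t + 1)) := by
    intro i hi t ht
    by_cases h' : t = τ i
    · subst h'
      exact hσU _ ht
    · exact hVU _ _ _ (hVall i hi t ht h')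
  let seg (W : ℕ → Ω → Ω → Prop) (i : ℕ) (a b : Ω) : Prop :=
    ∃ ρ : ℕ → Ω, ρ (τ (2 * i + 1)) = a ∧ ρ (τ (2 * i + 3)) = b ∧
      ∀ t, τ (2 * i + 1) ≤ t → t < τ (2 * i + 3) → W t (ρ t) (ρ (t + 1))
  -- On the segment between two odd positions, the last realization goes from `c` to `c` and the
  -- first from `z` to `z`, both without defect. The one defective at the even position in between
  -- goes from `c` to `z` in `U`. Merging gives a defect-free passage from `c` to `z`.
  obtain ⟨x, hx0, hxn, hx⟩ := h.exists_path (seg V) (seg U) (fun _ => c) (fun _ => z)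
    (fun i hi => ⟨σ (τ (2 * n + 2)), hc _ _ (by omega) (by omega), hc _ _ (by omega) (by omega),
      fun t h₁ h₂ => by
        have := hτ (2 * i + 3) (2 * n + 2) (by omega) (by omega)
        have := hτT (2 * n + 2) (by omega)
        exact hVall _ (by omega) t (by omega) (by omega)⟩)
    (fun i hi => ⟨σ (τ 0), hz _ _ (by omega) (by omega), hz _ _ (by omega) (by omega),
      fun t h₁ h₂ => by
        have := hτ 0 (2 * i + 1) (by omega) (by omega)
        have := hτT (2 * i + 3) (by omega)
        exact hVall _ (by omega) t (by omega) (by omega)⟩)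
    (fun i hi => ⟨σ (τ (2 * i + 2)), hc _ _ (by omega) (by omega), hz _ _ (by omega) (by omega),
      fun t h₁ h₂ => by
        have := hτT (2 * i + 3) (by omega)
        exact hUall _ (by omega) t (by omega)⟩)
    (by
      rintro i - s _ _ _ _ _ _ ⟨ρ₁, rfl, rfl, h₁⟩ ⟨ρ₂, rfl, rfl, h₂⟩ ⟨ρ₃, rfl, rfl, h₃⟩
      exact ⟨fun t => d s (ρ₁ t) (ρ₂ t) (ρ₃ t), rfl, rfl, fun t ht ht' =>
        hV _ _ _ _ _ _ _ _ (h₁ t ht ht') (h₂ t ht ht') (h₃ t ht ht')⟩)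
  have hreach : ∀ i ≤ n, ∃ π : ℕ → Ω, π 0 ∈ X ∧ (∀ t < τ (2 * i + 1), V t (π t) (π (t + 1))) ∧
      π (τ (2 * i + 1)) = x i := by
    intro i
    induction i with
    | zero =>
      intro _
      refine ⟨σ (τ (2 * n + 2)), hσX _ (hτT _ (by omega)), fun t ht => ?_, ?_⟩
      · have := hτ (2 * 0 + 1) (2 * n + 2) (by omega) (by omega)
        have := hτT (2 * n + 2) (by omega)
        exact hVall _ (by omega) t (by omega) (by omega)
      · rw [hx0]
        exact hc _ _ (by omega) (by omega)
    | succ i ih =>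
      intro hi
      obtain ⟨π, hπX, hπV, hπ⟩ := ih (by omega)
      obtain ⟨ρ, h₁, h₂, h₃⟩ := hx i hi
      obtain ⟨π', h₁', h₂', h₃'⟩ := exists_seq_glue
        (hτ' (2 * i + 1) (2 * i + 3) (by omega) (by omega)) hπX hπV h₃ (hπ.trans h₁.symm)
      exact ⟨π', h₁', h₂', h₃'.trans h₂⟩
  obtain ⟨π, hπX, hπV, hπ⟩ := hreach n le_rfl
  have h0 := hτ 0 (2 * n + 1) (by omega) (by omega)
  obtain ⟨π', h₁', h₂', h₃'⟩ := exists_seq_glue (q := T) (hτT _ (by omega)).le hπX hπV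
    (ρ := σ (τ 0)) (fun t ht ht' => hVall 0 (by omega) t ht' (by omega))
    (by rw [hπ, hxn, hz _ _ (by omega) (by omega)])
  exact ⟨π' 0, h₁', (hP _).2 ⟨π', rfl, h₂', h₃' ▸ hσY _ (hτT 0 (by omega))⟩⟩

/-! ### Tree formulas and arc consistency -/

/-- Tree-shaped primitive positive formulas; `unit true` asserts membership in the constraint set
of the current index. -/
inductive TreeFormula (I : Type*)
  | unit (m : Bool) : TreeFormula I
  | and (l r : TreeFormula I) : TreeFormula I
  | step (j : I) (t : TreeFormula I) : TreeFormula I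

namespace TreeFormula

variable {I Ω : Type*}

def Sat (E : I → Set Ω) (R : I → I → Ω → Ω → Prop) : TreeFormula I → I → Ω → Prop
  | unit m, i, a => m = true → a ∈ E i
  | and l r, i, a => Sat E R l i a ∧ Sat E R r i a
  | step j t, i, a => ∃ b, R i j a b ∧ Sat E R t j b

def marks : TreeFormula I → ℕ
  | unit m => if m then 1 else 0
  | and l r => l.marks + r.marks
  | step _ t => t.marks

def marked : TreeFormula I → I → List I
  | unit m, i => if m then [i] else []
  | and l r, i => l.marked i ++ r.marked i
  | step j t, _ => t.marked j

inductive Less : TreeFormula I → TreeFormula I → Prop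
  | unit : Less (.unit false) (.unit true)
  | left {l' l r} : Less l' l → Less (.and l' r) (.and l r)
  | right {l r' r} : Less r' r → Less (.and l r') (.and l r)
  | step {j t' t} : Less t' t → Less (.step j t') (.step j t)

theorem Less.marks_lt {t' t : TreeFormula I} (h : Less t' t) : t'.marks < t.marks := by
  induction h <;> simp_all [marks]

theorem exists_less {t : TreeFormula I} (h : 0 < t.marks) : ∃ t', Less t' t := by
  induction t with
  | unit m =>
    cases m with
    | false => simp [marks] at h
    | true => exact ⟨_, .unit⟩
  | and l r ihl ihr =>
    rw [marks] at h
    rcases Nat.eq_zero_or_pos l.marks with h' | h'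
    · exact (ihr (by omega)).imp' _ fun _ h => .right h
    · exact (ihl h').imp' _ fun _ h => .left h
  | step j t ih => exact (ih h).imp' _ fun _ h => .step h

theorem length_marked (t : TreeFormula I) (i : I) : (t.marked i).length = t.marks := by
  induction t generalizing i with
  | unit m => cases m <;> rfl
  | and l r ihl ihr => simp [marked, marks, ihl, ihr]
  | step j t ih => exact ih j

variable {E : I → Set Ω} {R : I → I → Ω → Ω → Prop}

theorem Less.sat {t' t : TreeFormula I} (h : Less t' t) {i : I} {a : Ω} (ht : t.Sat E R i a) :
    t'.Sat E R i a := by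
  induction h generalizing i a with
  | unit => simp [Sat]
  | left _ ih => exact ⟨ih ht.1, ht.2⟩
  | right _ ih => exact ⟨ht.1, ih ht.2⟩
  | step _ ih => exact ht.imp fun _ hb => ⟨hb.1, ih hb.2⟩

theorem sat_of_solution {s : I → Ω} (hs : ∀ i j, R i j (s i) (s j)) {t : TreeFormula I} {i : I}
    (h : ∀ q ∈ t.marked i, s q ∈ E q) : t.Sat E R i (s i) := by
  induction t generalizing i with
  | unit m =>
    rintro rfl
    exact h i (by simp [marked])
  | and l r ihl ihr =>
    exact ⟨ihl fun q hq => h q (List.mem_append_left _ hq),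
      ihr fun q hq => h q (List.mem_append_right _ hq)⟩
  | step j t ih => exact ⟨s j, hs i j, ih h⟩

theorem exists_forall_not_sat [Finite Ω] {i : I} {X : Set Ω}
    (h : ∀ a ∈ X, ∃ t : TreeFormula I, ¬ t.Sat E R i a) :
    ∃ t : TreeFormula I, ∀ a ∈ X, ¬ t.Sat E R i a := by
  induction X, X.toFinite using Set.Finite.induction_on with
  | empty => exact ⟨.unit false, by simp⟩
  | @insert a X _ _ ih =>
    obtain ⟨t, ht⟩ := ih fun b hb => h b (Set.mem_insert_of_mem _ hb)
    obtain ⟨t', ht'⟩ := h a (Set.mem_insert _ _)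
    refine ⟨.and t t', fun b hb hsat => ?_⟩
    rcases hb with rfl | hb
    · exact ht' hsat.2
    · exact ht b hb hsat.1

variable {d : ℕ → Ω → Ω → Ω → Ω}

theorem sat_closed (hE : ∀ i s, ∀ a ∈ E i, ∀ b, ∀ c ∈ E i, d s a b c ∈ E i)
    (hR : ∀ i j s a a' b b' c c', R i j a a' → R i j b b' → R i j c c' →
      R i j (d s a b c) (d s a' b' c'))
    (t : TreeFormula I) {i : I} {s : ℕ} {a b c : Ω} (ha : t.Sat E R i a)
    (hb : t.Sat E R i b) (hc : t.Sat E R i c) : t.Sat E R i (d s a b c) := by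
  induction t generalizing i a b c with
  | unit m => exact fun hm => hE _ _ _ (ha hm) _ _ (hc hm)
  | and l r ihl ihr => exact ⟨ihl ha.1 hb.1 hc.1, ihr ha.2 hb.2 hc.2⟩
  | step j t ih =>
    obtain ⟨a', ha, ha'⟩ := ha
    obtain ⟨b', hb, hb'⟩ := hb
    obtain ⟨c', hc, hc'⟩ := hc
    exact ⟨_, hR _ _ _ _ _ _ _ _ _ ha hb hc, ih ha' hb' hc'⟩

/-- Only the erased mark is missing for the middle argument, and there `E` tolerates any middle
value; elsewhere `sat_closed` applies. -/
theorem Less.sat_of_sat (hE : ∀ i s, ∀ a ∈ E i, ∀ b, ∀ c ∈ E i, d s a b c ∈ E i)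
    (hR : ∀ i j s a a' b b' c c', R i j a a' → R i j b b' → R i j c c' →
      R i j (d s a b c) (d s a' b' c'))
    {t' t : TreeFormula I} (h : Less t' t) {i : I} {s : ℕ} {a b c : Ω} (ha : t.Sat E R i a)
    (hb : t'.Sat E R i b) (hc : t.Sat E R i c) : t.Sat E R i (d s a b c) := by
  induction h generalizing i a b c with
  | unit => exact fun _ => hE _ _ _ (ha rfl) _ _ (hc rfl)
  | left _ ih => exact ⟨ih ha.1 hb.1 hc.1, sat_closed hE hR _ ha.2 hb.2 hc.2⟩
  | right _ ih => exact ⟨sat_closed hE hR _ ha.1 hb.1 hc.1, ih ha.2 hb.2 hc.2⟩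
  | step _ ih =>
    obtain ⟨a', ha, ha'⟩ := ha
    obtain ⟨b', hb, hb'⟩ := hb
    obtain ⟨c', hc, hc'⟩ := hc
    exact ⟨_, hR _ _ _ _ _ _ _ _ _ ha hb hc, ih ha' hb' hc'⟩

/-- At a conjunction, descend into a branch keeping at least half of the required marks. The other
branch, with one of its marks erased as relaxation, supplies one link. Hence marks exponential in
`T` suffice. If one branch has all the required marks, the other merely restricts the source. -/
theorem hasCriticalChain (hE : ∀ i s, ∀ a ∈ E i, ∀ b, ∀ c ∈ E i, d s a b c ∈ E i)
    (hR : ∀ i j s a a' b b' c c', R i j a a' → R i j b b' → R i j c c' →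
      R i j (d s a b c) (d s a' b' c'))
    (t : TreeFormula I) {i : I} {T : ℕ} {X : Set Ω} (hT : 2 ^ T ≤ t.marks)
    (hX : ∀ t', Less t' t → ∃ a ∈ X, t'.Sat E R i a) :
    HasCriticalChain d T (t.Sat E R i) X := by
  induction t generalizing i T X with
  | unit m =>
    cases T with
    | zero => exact .zero
    | succ T =>
    exfalso
    have : (unit m : TreeFormula I).marks ≤ 1 := by cases m <;> simp [marks]
    have := Nat.one_lt_two_pow (Nat.succ_ne_zero T)
    omega
  | step j t ih =>
    refine .comp (hR i j) (ih hT fun t' ht' => ?_)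
    obtain ⟨a, ha, b, hab, hb⟩ := hX _ (.step ht')
    exact ⟨b, ⟨a, ha, hab⟩, hb⟩
  | and l r ihl ihr =>
    cases T with
    | zero => exact .zero
    | succ T =>
    have hl : ∀ l', Less l' l → ∃ a ∈ {a | a ∈ X ∧ r.Sat E R i a}, l'.Sat E R i a := fun l' h => by
      obtain ⟨a, ha, h₁, h₂⟩ := hX _ h.left
      exact ⟨a, ⟨ha, h₂⟩, h₁⟩
    have hr : ∀ r', Less r' r → ∃ a ∈ {a | a ∈ X ∧ l.Sat E R i a}, r'.Sat E R i a := fun r' h => by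
      obtain ⟨a, ha, h₁, h₂⟩ := hX _ h.right
      exact ⟨a, ⟨ha, h₁⟩, h₂⟩
    by_cases h₁ : 2 ^ (T + 1) ≤ l.marks
    · exact (HasCriticalChain.restrict (fun _ _ _ _ => sat_closed hE hR r) (ihl h₁ hl)).congr
        fun _ => and_comm
    by_cases h₂ : 2 ^ (T + 1) ≤ r.marks
    · exact HasCriticalChain.restrict (fun _ _ _ _ => sat_closed hE hR l) (ihr h₂ hr)
    have h₃ : 2 ^ (T + 1) ≤ l.marks + r.marks := hT
    have h₄ : 2 ^ (T + 1) = 2 ^ T + 2 ^ T := by rw [pow_succ]; omega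
    by_cases h₅ : 2 ^ T ≤ l.marks
    · obtain ⟨r', hr'⟩ := exists_less (t := r) (by omega)
      refine (HasCriticalChain.cons (fun a => hr'.sat)
        (fun s a b c => hr'.sat_of_sat hE hR) ?_ ?_).congr fun _ => and_comm
      · exact ihl h₅ hl
      · obtain ⟨a, ha, h₁, h₂⟩ := hX _ hr'.right
        exact ⟨a, ha, h₂, h₁⟩
    · obtain ⟨l', hl'⟩ := exists_less (t := l) (by omega)
      refine HasCriticalChain.cons (fun a => hl'.sat) (fun s a b c => hl'.sat_of_sat hE hR) ?_ ?_
      · exact ihr (by omega) hr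
      · exact hX _ hl'.left

end TreeFormula

/-- Arc consistency from local satisfiability. -/
theorem exists_arc_consistent (Ω : Type u) [Finite Ω] [Nonempty Ω] (n : ℕ) :
    ∃ N, ∀ d : ℕ → Ω → Ω → Ω → Ω, IsJonssonChain n d → ∀ {I : Type v}
      (S : Set (I → Ω)) (E : I → Set Ω),
      (∀ s, ∀ f ∈ S, ∀ g ∈ S, ∀ h ∈ S, (fun i => d s (f i) (g i) (h i)) ∈ S) →
      (∀ i s, ∀ a ∈ E i, ∀ b, ∀ c ∈ E i, d s a b c ∈ E i) →
      (∀ F : List I, F.length ≤ N → ∃ s ∈ S, ∀ q ∈ F, s q ∈ E q) →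
      ∃ P : I → Set Ω, (∀ i, (P i).Nonempty) ∧ (∀ i, P i ⊆ E i) ∧
        (∀ i, ∀ a ∈ P i, ∃ s ∈ S, s i = a) ∧
        (∀ i j, ∀ a ∈ P i, ∃ b ∈ P j, ∃ s ∈ S, s i = a ∧ s j = b) ∧
        ∀ i s, ∀ a ∈ P i, ∀ f ∈ S, ∀ c ∈ P i, d s a (f i) c ∈ P i := by
  obtain ⟨T, hT⟩ := HasCriticalChain.exists_mem Ω n
  refine ⟨2 ^ T, fun d h I S E hS hE hsat => ?_⟩
  let R : I → I → Ω → Ω → Prop := fun i j a b => ∃ s ∈ S, s i = a ∧ s j = b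
  have hR : ∀ i j s a a' b b' c c', R i j a a' → R i j b b' → R i j c c' →
      R i j (d s a b c) (d s a' b' c') := by
    rintro i j s _ _ _ _ _ _ ⟨f, hf, rfl, rfl⟩ ⟨g, hg, rfl, rfl⟩ ⟨k, hk, rfl, rfl⟩
    exact ⟨_, hS s f hf g hg k hk, rfl, rfl⟩
  let U : I → Set Ω := fun i => {a | ∃ s ∈ S, s i = a}
  -- The values satisfying every tree formula form the largest candidate; finiteness of `Ω` lets one
  -- conjunction refute all the other values.
  refine ⟨fun i => {a | a ∈ U i ∧ ∀ t : TreeFormula I, t.Sat E R i a}, ?_,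
    fun i a ha => ha.2 (.unit true) rfl, fun i a ha => ha.1, ?_, ?_⟩
  · intro i
    by_contra hP
    have hex : ∃ m, ∃ t : TreeFormula I, t.marks = m ∧ ∀ a ∈ U i, ¬ t.Sat E R i a := by
      obtain ⟨t, ht⟩ := TreeFormula.exists_forall_not_sat (E := E) (R := R) (i := i) (X := U i)
        fun a ha => by
          by_contra h'
          push Not at h'
          exact hP ⟨a, ha, h'⟩
      exact ⟨_, t, rfl, ht⟩
    classical
    obtain ⟨⟨t, htm, ht⟩, hmin⟩ := And.intro (Nat.find_spec hex) fun j => Nat.find_min hex (m := j)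
    rw [← htm] at hmin
    by_cases hm : 2 ^ T ≤ t.marks
    · obtain ⟨a, ha, hta⟩ := hT d h _ _ (TreeFormula.hasCriticalChain hE hR t hm (X := U i) (i := i)
        fun t' ht' => by
          by_contra h'
          push Not at h'
          exact hmin _ ht'.marks_lt ⟨t', rfl, h'⟩)
      exact ht a ha hta
    · obtain ⟨s, hs, hsE⟩ := hsat (t.marked i) (by rw [t.length_marked]; omega)
      exact ht (s i) ⟨s, hs, rfl⟩ (TreeFormula.sat_of_solution (fun i j => ⟨s, hs, rfl, rfl⟩) hsE)
  · rintro i j a ⟨ha, hta⟩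
    by_contra hb
    obtain ⟨t, ht⟩ := TreeFormula.exists_forall_not_sat (E := E) (R := R) (i := j)
      (X := {b | R i j a b}) fun b hab => by
        by_contra h'
        push Not at h'
        obtain ⟨s, hs, h₁, h₂⟩ := hab
        exact hb ⟨b, ⟨⟨s, hs, h₂⟩, h'⟩, s, hs, h₁, h₂⟩
    obtain ⟨b, hab, htb⟩ := hta (.step j t)
    exact ht b hab htb
  · rintro i s a ⟨⟨f, hf, rfl⟩, hta⟩ g hg c ⟨⟨k, hk, rfl⟩, htc⟩
    refine ⟨⟨_, hS s f hf g hg k hk, rfl⟩, fun t => ?_⟩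
    have key : ∀ (t : TreeFormula I) {i a b c}, t.Sat E R i a → b ∈ U i → t.Sat E R i c →
        t.Sat E R i (d s a b c) := by
      intro t
      induction t with
      | unit m => exact fun ha _ hc hm => hE _ _ _ (ha hm) _ _ (hc hm)
      | and l r ihl ihr => exact fun ha hb hc => ⟨ihl ha.1 hb hc.1, ihr ha.2 hb hc.2⟩
      | step j t ih =>
        rintro i a _ c ⟨a', ha, ha'⟩ ⟨g, hg, rfl⟩ ⟨c', hc, hc'⟩
        exact ⟨_, hR _ _ _ _ _ _ _ _ _ ha ⟨g, hg, rfl, rfl⟩ hc, ih ha' ⟨g, hg, rfl⟩ hc'⟩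
    exact key t (hta t) ⟨g, hg, rfl⟩ (htc t)

/-! ### Path-consistent networks and pattern walks -/

/-- `C` absorbs the projection of `S` to the coordinate `i` with respect to the operations `d`. -/
def IsCoordIdeal {X Ω : Type*} (d : ℕ → Ω → Ω → Ω → Ω) (S : Set (X → Ω)) (i : X) (C : Set Ω) :
    Prop :=
  ∀ s, ∀ a ∈ C, ∀ f ∈ S, ∀ c ∈ C, d s a (f i) c ∈ C

/-- A path-consistent binary network of constraints all of which are absorbing
subrelations of the binary projections of `S`. -/
structure IsAbsorbingNetwork {X Ω : Type*} (d : ℕ → Ω → Ω → Ω → Ω) (S : Set (X → Ω))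
    (Q : X → X → Ω → Ω → Prop) : Prop where
  symm : ∀ i j a b, Q i j a b → Q j i b a
  path : ∀ i j a b, Q i j a b → ∀ l, ∃ c, Q i l a c ∧ Q l j c b
  solution : ∀ i j a b, Q i j a b → ∃ s ∈ S, s i = a ∧ s j = b
  absorb : ∀ i j s a a' c c', ∀ f ∈ S, Q i j a a' → Q i j c c' →
    Q i j (d s a (f i) c) (d s a' (f j) c')

structure IsAbsorbingReduction {X Ω : Type*} (d : ℕ → Ω → Ω → Ω → Ω) (S : Set (X → Ω))
    (Q : X → X → Ω → Ω → Prop) (D : X → Set Ω) : Prop where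
  nonempty : ∀ i, (D i).Nonempty
  sub : ∀ i, ∀ a ∈ D i, Q i i a a
  arc : ∀ i j, ∀ a ∈ D i, ∃ b ∈ D j, Q i j a b
  ideal : ∀ i, IsCoordIdeal d S i (D i)

section Walks

variable {X Ω : Type*}

/-- The last vertex of the walk that starts at `i` and visits the list `p`. -/
def walkEnd (i : X) (p : List X) : X := p.foldl (fun _ l => l) i

theorem walkEnd_append (i : X) (p q : List X) :
    walkEnd i (p ++ q) = walkEnd (walkEnd i p) q := List.foldl_append

/-- `a` and `b` are joined by a realization in `D` of the pattern `p` starting at `i`. -/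
def PatternWalk (Q : X → X → Ω → Ω → Prop) (D : X → Set Ω) : X → List X → Ω → Ω → Prop
  | _, [], a, b => a = b
  | i, l :: p, a, b => ∃ c ∈ D l, Q i l a c ∧ PatternWalk Q D l p c b

variable {Q : X → X → Ω → Ω → Prop} {D : X → Set Ω}

theorem patternWalk_append {i : X} {p q : List X} {a c : Ω} :
    PatternWalk Q D i (p ++ q) a c ↔
      ∃ b, PatternWalk Q D i p a b ∧ PatternWalk Q D (walkEnd i p) q b c := by
  induction p generalizing i a with
  | nil => simp [PatternWalk, walkEnd]
  | cons l p ih =>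
    simp only [List.cons_append, PatternWalk, ih]
    constructor
    · rintro ⟨e, he, hae, b, h₁, h₂⟩
      exact ⟨b, ⟨e, he, hae, h₁⟩, h₂⟩
    · rintro ⟨b, ⟨e, he, hae, h₁⟩, h₂⟩
      exact ⟨e, he, hae, b, h₁, h₂⟩

variable {d : ℕ → Ω → Ω → Ω → Ω} {S : Set (X → Ω)}

theorem IsAbsorbingNetwork.eq (hQ : IsAbsorbingNetwork d S Q) {i : X} {a b : Ω}
    (h : Q i i a b) : a = b := by
  obtain ⟨s, -, rfl, rfl⟩ := hQ.solution _ _ _ _ h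
  rfl

/-- Path consistency subdivides an edge along any pattern with the same ends. -/
theorem IsAbsorbingNetwork.patternWalk (hQ : IsAbsorbingNetwork d S Q) {i : X} {p : List X}
    {a b : Ω} (h : Q i (walkEnd i p) a b) : PatternWalk Q (fun _ => Set.univ) i p a b := by
  induction p generalizing i a with
  | nil => exact hQ.eq h
  | cons l p ih =>
    obtain ⟨c, h₁, h₂⟩ := hQ.path _ _ _ _ h l
    exact ⟨c, trivial, h₁, ih h₂⟩

namespace IsAbsorbingReduction

theorem patternWalk_closed (hD : IsAbsorbingReduction d S Q D) (hQ : IsAbsorbingNetwork d S Q)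
    {i : X} {p : List X} {s : ℕ} {a a' b b' c c' : Ω} (ha : PatternWalk Q D i p a a')
    (hb : PatternWalk Q (fun _ => Set.univ) i p b b') (hc : PatternWalk Q D i p c c') :
    PatternWalk Q D i p (d s a b c) (d s a' b' c') := by
  induction p generalizing i a b c with
  | nil => cases ha; cases hb; cases hc; rfl
  | cons l p ih =>
    obtain ⟨a₁, ha, hQa, ha'⟩ := ha
    obtain ⟨b₁, -, hQb, hb'⟩ := hb
    obtain ⟨c₁, hc, hQc, hc'⟩ := hc
    obtain ⟨f, hf, rfl, rfl⟩ := hQ.solution _ _ _ _ hQb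
    exact ⟨_, hD.ideal l s _ ha f hf _ hc, hQ.absorb _ _ _ _ _ _ _ f hf hQa hQc, ih ha' hb' hc'⟩

theorem exists_walk_from (hD : IsAbsorbingReduction d S Q D) {i : X} (p : List X) {a : Ω}
    (ha : a ∈ D i) : ∃ b ∈ D (walkEnd i p), PatternWalk Q D i p a b := by
  induction p generalizing i a with
  | nil => exact ⟨a, ha, rfl⟩
  | cons l p ih =>
    obtain ⟨c, hc, hac⟩ := hD.arc i l a ha
    obtain ⟨b, hb, h⟩ := ih hc
    exact ⟨b, hb, c, hc, hac, h⟩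

theorem exists_walk_to (hD : IsAbsorbingReduction d S Q D) (hQ : IsAbsorbingNetwork d S Q)
    {i : X} (p : List X) {b : Ω} (hb : b ∈ D (walkEnd i p)) :
    ∃ a ∈ D i, PatternWalk Q D i p a b := by
  induction p generalizing i with
  | nil => exact ⟨b, hb, rfl⟩
  | cons l p ih =>
    obtain ⟨c, hc, h⟩ := ih hb
    obtain ⟨a, ha, hca⟩ := hD.arc l i c hc
    exact ⟨a, ha, c, hc, hQ.symm _ _ _ _ hca, h⟩

end IsAbsorbingReduction

end Walks

/-- A loop at the start pads all walks to one common length. -/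
theorem exists_relWalk_length {Ω : Type*} [Finite Ω] (U : Ω → Ω → Prop) :
    ∃ M, ∀ a b, Relation.ReflTransGen U a b → RelWalk U 1 a a → RelWalk U M a b := by
  classical
  have h : ∀ x : Ω × Ω, ∃ m, Relation.ReflTransGen U x.1 x.2 → RelWalk U m x.1 x.2 := by
    rintro ⟨a, b⟩
    by_cases hab : Relation.ReflTransGen U a b
    · suffices ∃ m, RelWalk U m a b from this.imp fun m hm _ => hm
      induction hab with
      | refl => exact ⟨0, rfl⟩
      | tail _ h ih => exact ih.imp' Nat.succ fun m hm => ⟨_, hm, h⟩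
    · exact ⟨0, fun h' => absurd h' hab⟩
  choose m hm using h
  obtain ⟨M, hM⟩ := (Set.finite_range m).bddAbove
  refine ⟨M, fun a b hab haa => ?_⟩
  have h₁ : m (a, b) ≤ M := hM ⟨_, rfl⟩
  have h₂ := (haa.mul (M - m (a, b))).trans (hm (a, b) hab)
  rwa [one_mul, Nat.sub_add_cancel h₁] at h₂

/-! ### Minimal absorbing reductions -/

section Reduction

variable {X Ω : Type*} {n : ℕ} {d : ℕ → Ω → Ω → Ω → Ω} {S : Set (X → Ω)}
  {Q : X → X → Ω → Ω → Prop} {D : X → Set Ω}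

/-- Elements reached from `a` by iterating the closed pattern `e` at `z`, stopping midway. -/
def PatternReach (Q : X → X → Ω → Ω → Prop) (z : X) (e : List X) (a : Ω) (j : X) (b : Ω) : Prop :=
  ∃ e₁ e₂, e = e₁ ++ e₂ ∧ walkEnd z e₁ = j ∧ ∃ a',
    Relation.ReflTransGen (PatternWalk Q (fun _ => Set.univ) z e) a a' ∧
    PatternWalk Q (fun _ => Set.univ) z e₁ a' b

theorem PatternReach.step (hQ : IsAbsorbingNetwork d S Q) {z : X} {e : List X}
    (he : walkEnd z e = z) {a b b' : Ω} {j l : X} (h : PatternReach Q z e a j b)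
    (hl : ∃ f₁ f₂, e = f₁ ++ f₂ ∧ walkEnd z f₁ = l) (hb : Q j l b b') :
    PatternReach Q z e a l b' := by
  obtain ⟨e₁, e₂, rfl, rfl, a', haa', ha'b⟩ := h
  obtain ⟨f₁, f₂, hf, rfl⟩ := hl
  have h₁ : walkEnd (walkEnd z e₁) (e₂ ++ f₁) = walkEnd z f₁ := by
    rw [walkEnd_append, ← walkEnd_append z, he]
  rw [← h₁] at hb
  obtain ⟨a'', h₂, h₃⟩ := patternWalk_append.1 (hQ.patternWalk hb)
  rw [← walkEnd_append, he] at h₃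
  exact ⟨f₁, f₂, hf, rfl, a'', haa'.tail (patternWalk_append.2 ⟨b, ha'b, h₂⟩), h₃⟩

theorem PatternReach.reflTransGen (hQ : IsAbsorbingNetwork d S Q) {z : X} {e : List X}
    (he : walkEnd z e = z) {a b : Ω} (h : PatternReach Q z e a z b) (hb : Q z z b b) :
    Relation.ReflTransGen (PatternWalk Q (fun _ => Set.univ) z e) a b := by
  obtain ⟨e₁, e₂, rfl, hz, a', haa', ha'b⟩ := h
  refine haa'.tail (patternWalk_append.2 ⟨b, ha'b, hQ.patternWalk ?_⟩)
  rwa [← walkEnd_append, he, hz]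

/-- Every edge can be completed to a traversal of the closed pattern, and edges are symmetric, so
reachability is constant along partial walks of the pattern. -/
theorem patternReach_iff (hQ : IsAbsorbingNetwork d S Q) {z : X} {e : List X}
    (he : walkEnd z e = z) {a b b' : Ω} {f r g : List X} (hr : e = f ++ r ++ g)
    (h : PatternWalk Q D (walkEnd z f) r b b') :
    PatternReach Q z e a (walkEnd z f) b ↔ PatternReach Q z e a (walkEnd z (f ++ r)) b' := by
  induction r generalizing f b with
  | nil =>
    cases h
    rw [List.append_nil]
  | cons l r ih =>
    obtain ⟨c, -, hbc, hc⟩ := h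
    have hl : walkEnd z (f ++ [l]) = l := by rw [walkEnd_append]; rfl
    have := ih (f := f ++ [l]) (b := c) (by simpa using hr) (by rwa [hl])
    rw [hl, List.append_assoc, List.singleton_append] at this
    rw [← this]
    exact ⟨fun h => h.step hQ he ⟨f ++ [l], r ++ g, by simpa using hr, hl⟩ hbc,
      fun h => h.step hQ he ⟨f, l :: r ++ g, by simpa using hr, rfl⟩ (hQ.symm _ _ _ _ hbc)⟩

/-- Let `V` and `U` be the relations of the loop `p ++ q` in `D` and in the whole network. `V`
preserves `C`, so it is enough to join `c` to `x` by `V`-steps. Forward `V`-walks from `c` and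
backward ones from `x` exist by arc consistency, and `U` links them because `PatternReach` does not
separate them. -/
theorem IsAbsorbingReduction.subset_of_walks [Finite Ω] (h : IsJonssonChain n d)
    (hQ : IsAbsorbingNetwork d S Q) (hD : IsAbsorbingReduction d S Q D) {z : X} {p q : List X}
    (hp : walkEnd z p = z) (hq : walkEnd z q = z) {C C' : Set Ω} (hC : C ⊆ D z) (hC' : C' ⊆ D z)
    (hCp : ∀ b, b ∈ C' ↔ ∃ a ∈ C, PatternWalk Q D z p a b)
    (hCq : ∀ b, b ∈ C ↔ ∃ a ∈ C', PatternWalk Q D z q a b) : C' ⊆ C := by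
  intro x hx
  obtain ⟨c, hc, hcx⟩ := (hCp x).1 hx
  set e := p ++ q with he'
  have he : walkEnd z e = z := by rw [walkEnd_append, hp, hq]
  let V := PatternWalk Q D z e
  let U := PatternWalk Q (fun _ => Set.univ) z e
  obtain ⟨M, hM⟩ := exists_relWalk_length U
  have hVC : ∀ l, ∀ a ∈ C, ∀ b, RelWalk V l a b → b ∈ C := by
    intro l
    induction l with
    | zero => rintro a ha _ rfl; exact ha
    | succ l ih =>
      rintro a ha b ⟨b', h₁, h₂⟩
      obtain ⟨y, h₃, h₄⟩ := patternWalk_append.1 h₂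
      rw [hp] at h₄
      exact (hCq b).2 ⟨y, (hCp y).2 ⟨b', ih a ha b' h₁, h₃⟩, h₄⟩
  have hfwd : ∀ l, ∀ a ∈ D z, ∃ b ∈ D z, RelWalk V l a b := by
    intro l
    induction l with
    | zero => exact fun a ha => ⟨a, ha, rfl⟩
    | succ l ih =>
      intro a ha
      obtain ⟨b, hb, hab⟩ := ih a ha
      obtain ⟨b', hb', hbb⟩ := hD.exists_walk_from e hb
      rw [he] at hb'
      exact ⟨b', hb', b, hab, hbb⟩
  have hbwd : ∀ l, ∀ b ∈ D z, ∃ a ∈ D z, RelWalk V l a b := by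
    intro l
    induction l with
    | zero => exact fun a ha => ⟨a, ha, rfl⟩
    | succ l ih =>
      intro b hb
      obtain ⟨b', hb', hbb⟩ := hD.exists_walk_to hQ e (he.symm ▸ hb)
      obtain ⟨a, ha, hab⟩ := ih b' hb'
      exact ⟨a, ha, b', hab, hbb⟩
  have hinvV : ∀ a b b', V b b' → (PatternReach Q z e a z b ↔ PatternReach Q z e a z b') := by
    intro a b b' hb
    have := patternReach_iff hQ he (a := a) (f := []) (r := e) (g := []) (by simp) hb
    rwa [List.nil_append, he] at this
  have hinv : ∀ l a b b', RelWalk V l b b' →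
      (PatternReach Q z e a z b ↔ PatternReach Q z e a z b') := by
    intro l a b b' hb
    induction l generalizing b' with
    | zero => cases hb; rfl
    | succ l ih =>
      obtain ⟨y, h₁, h₂⟩ := hb
      rw [ih _ h₁, hinvV _ _ _ h₂]
  have hinvp : ∀ a, PatternReach Q z e a z c ↔ PatternReach Q z e a z x := by
    intro a
    have := patternReach_iff hQ he (a := a) (f := []) (r := p) (g := q) (by simp [he']) hcx
    rwa [List.nil_append, hp] at this
  choose! f hfD hf using hfwd M
  choose! g hgD hg using hbwd M
  have hfD' : ∀ t, f^[t] c ∈ D z := fun t => by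
    induction t with
    | zero => exact hC hc
    | succ t ih => rw [Function.iterate_succ_apply']; exact hfD _ ih
  have hgD' : ∀ t, g^[t] x ∈ D z := fun t => by
    induction t with
    | zero => exact hC' hx
    | succ t ih => rw [Function.iterate_succ_apply']; exact hgD _ ih
  have hf' : ∀ t, RelWalk V M (f^[t] c) (f^[t + 1] c) := fun t => by
    rw [Function.iterate_succ_apply']; exact hf _ (hfD' t)
  have hg' : ∀ t, RelWalk V M (g^[t + 1] x) (g^[t] x) := fun t => by
    rw [Function.iterate_succ_apply']; exact hg _ (hgD' t)
  have hinvf : ∀ t a, PatternReach Q z e a z c ↔ PatternReach Q z e a z (f^[t] c) := by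
    intro t a
    induction t with
    | zero => rfl
    | succ t ih => rw [ih, hinv _ _ _ _ (hf' t)]
  have hinvg : ∀ t a, PatternReach Q z e a z x ↔ PatternReach Q z e a z (g^[t] x) := by
    intro t a
    induction t with
    | zero => rfl
    | succ t ih => rw [ih, hinv _ _ _ _ (hg' t)]
  -- The second walk is indexed by `n - t` so that it ends in `x` at time `n`.
  obtain ⟨y, hy0, hyn, hy⟩ := h.exists_path (fun _ => RelWalk V M) (fun _ => RelWalk U M)
    (fun t => f^[t] c) (fun t => g^[n - t] x) (fun t _ => hf' t)
    (fun t ht => by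
      have := hg' (n - (t + 1))
      rwa [show n - (t + 1) + 1 = n - t by omega] at this)
    (fun t _ => by
      have hfz := hD.sub z _ (hfD' t)
      refine hM _ _ (PatternReach.reflTransGen hQ he ?_ (hD.sub z _ (hgD' _)))
        ⟨_, rfl, hQ.patternWalk (by rwa [he])⟩
      rw [← hinvg, ← hinvp, hinvf t]
      exact ⟨[], e, rfl, rfl, _, .refl, rfl⟩)
    (fun _ _ s _ _ _ _ _ _ h₁ h₂ h₃ =>
      RelWalk.closed (fun _ _ _ _ _ _ => hD.patternWalk_closed hQ) h₁ h₂ h₃)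
  have hyC : ∀ t ≤ n, y t ∈ C := by
    intro t
    induction t with
    | zero => exact fun _ => hy0 ▸ hc
    | succ t ih => exact fun ht => hVC M _ (ih (by omega)) _ (hy t (by omega))
  have := hyC n le_rfl
  rw [hyn, Nat.sub_self] at this
  exact this

theorem exists_terminal {α : Type*} [Finite α] (r : α → α → Prop) (x : α) :
    ∃ y, Relation.ReflTransGen r x y ∧
      ∀ z, Relation.ReflTransGen r y z → Relation.ReflTransGen r z y := by
  obtain ⟨y, hy, hmin⟩ := Set.exists_min_image {y | Relation.ReflTransGen r x y}
    (fun y => {z | Relation.ReflTransGen r y z}.ncard) (Set.toFinite _) ⟨x, .refl⟩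
  refine ⟨y, hy, fun z hz => ?_⟩
  have : {w | Relation.ReflTransGen r z w} = {w | Relation.ReflTransGen r y w} :=
    Set.eq_of_subset_of_ncard_le (fun w hw => hz.trans hw) (hmin z (hy.trans hz)) (Set.toFinite _)
  have hy' : y ∈ {w | Relation.ReflTransGen r y w} := .refl
  rw [← this] at hy'
  exact hy'

/-- Propagation of a subset along an arc of the network. -/
def arcImage (Q : X → X → Ω → Ω → Prop) (D : X → Set Ω) (i j : X) (C : Set Ω) : Set Ω :=
  {b | b ∈ D j ∧ ∃ a ∈ C, Q i j a b}

/-- Proper coordinate ideals are propagated along arcs until a terminal strongly connected class is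
reached. Within it `subset_of_walks` leaves only one set per coordinate. Replacing `D` by these sets
keeps arc consistency, since propagation from the class either stays in it or fills `D i`. -/
theorem IsAbsorbingReduction.exists_smaller [Finite X] [Finite Ω] (h : IsJonssonChain n d)
    (hQ : IsAbsorbingNetwork d S Q) (hD : IsAbsorbingReduction d S Q D) {i₀ : X} {C₀ : Set Ω}
    (hC₀ : C₀ ⊆ D i₀) (hne₀ : C₀.Nonempty) (hid₀ : IsCoordIdeal d S i₀ C₀) (hCD₀ : C₀ ≠ D i₀) :
    ∃ D' < D, IsAbsorbingReduction d S Q D' := by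
  let good (x : X × Set Ω) : Prop :=
    x.2 ⊆ D x.1 ∧ x.2 ≠ D x.1 ∧ x.2.Nonempty ∧ IsCoordIdeal d S x.1 x.2
  let r (x y : X × Set Ω) : Prop := y.2 = arcImage Q D x.1 y.1 x.2 ∧ y.2 ≠ D y.1
  have hgood : ∀ x y, good x → r x y → good y := by
    rintro ⟨i, C⟩ ⟨j, C'⟩ ⟨hC, -, ⟨a, ha⟩, hid⟩ ⟨hC', hne⟩
    replace hC' : C' = arcImage Q D i j C := hC'
    subst hC'
    refine ⟨fun b hb => hb.1, hne, ?_, ?_⟩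
    · obtain ⟨b, hb, hab⟩ := hD.arc i j a (hC ha)
      exact ⟨b, hb, a, ha, hab⟩
    · rintro s b ⟨hb, a, ha, hab⟩ f hf c ⟨hc, a', ha', hac⟩
      exact ⟨hD.ideal j s b hb f hf c hc, _, hid s a ha f hf a' ha',
        hQ.absorb _ _ _ _ _ _ _ f hf hab hac⟩
  have hgood' : ∀ x y, good x → Relation.ReflTransGen r x y → good y := by
    intro x y hx hxy
    induction hxy with
    | refl => exact hx
    | tail _ h ih => exact hgood _ _ ih h
  have hwalk : ∀ x y, Relation.ReflTransGen r x y → ∃ p, walkEnd x.1 p = y.1 ∧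
      ∀ b, b ∈ y.2 ↔ ∃ a ∈ x.2, PatternWalk Q D x.1 p a b := by
    intro x y hxy
    induction hxy with
    | refl => exact ⟨[], rfl, by simp [PatternWalk]⟩
    | @tail y w _ h ih =>
      obtain ⟨p, hp, hb⟩ := ih
      refine ⟨p ++ [w.1], by rw [walkEnd_append]; rfl, fun b => ?_⟩
      rw [h.1]
      simp only [patternWalk_append, hp, PatternWalk, arcImage, Set.mem_ofPred_eq, hb]
      constructor
      · rintro ⟨hb, c, ⟨a, ha, hac⟩, hcb⟩
        exact ⟨a, ha, c, hac, b, hb, hcb, rfl⟩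
      · rintro ⟨a, ha, c, hac, _, hb, hcb, rfl⟩
        exact ⟨hb, c, ⟨a, ha, hac⟩, hcb⟩
  obtain ⟨y, hxy, hy⟩ := exists_terminal r (i₀, C₀)
  have hygood := hgood' _ _ ⟨hC₀, hCD₀, hne₀, hid₀⟩ hxy
  let K (i : X) (C : Set Ω) : Prop := Relation.ReflTransGen r y (i, C)
  have hKgood : ∀ i C, K i C → good (i, C) := fun i C hK => hgood' _ _ hygood hK
  have hKsub : ∀ i C C', K i C → K i C' → C' ⊆ C := by
    intro i C C' hC hC'
    obtain ⟨p, hp, hCp⟩ := hwalk _ _ ((hy _ hC).trans hC')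
    obtain ⟨q, hq, hCq⟩ := hwalk _ _ ((hy _ hC').trans hC)
    exact hD.subset_of_walks h hQ hp hq (hKgood i C hC).1 (hKgood i C' hC').1 hCp hCq
  let D' : X → Set Ω := fun i => {a | a ∈ D i ∧ ∀ C, K i C → a ∈ C}
  have hD'K : ∀ i C, K i C → D' i = C := fun i C hC => by
    ext a
    exact ⟨fun ha => ha.2 C hC,
      fun ha => ⟨(hKgood i C hC).1 ha, fun C' hC' => hKsub i C' C hC' hC ha⟩⟩
  have hD'D : ∀ i, (¬ ∃ C, K i C) → D' i = D i := fun i hi => by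
    ext a
    exact ⟨fun ha => ha.1, fun ha => ⟨ha, fun C hC => absurd ⟨C, hC⟩ hi⟩⟩
  refine ⟨D', lt_of_le_of_ne (fun i a ha => ha.1) fun heq => ?_, ⟨fun i => ?_,
    fun i a ha => hD.sub i a ha.1, fun i j a ha => ?_, fun i => ?_⟩⟩
  · have := hD'K y.1 y.2 .refl
    rw [heq] at this
    exact hygood.2.1 this.symm
  · by_cases hi : ∃ C, K i C
    · obtain ⟨C, hC⟩ := hi
      rw [hD'K i C hC]
      exact (hKgood i C hC).2.2.1
    · rw [hD'D i hi]
      exact hD.nonempty i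
  · by_cases hj : ∃ C, K j C
    · obtain ⟨C, hC⟩ := hj
      have hmem : a ∈ arcImage Q D j i C := by
        by_cases hproper : arcImage Q D j i C = D i
        · rw [hproper]
          exact ha.1
        · exact ha.2 _ (hC.tail ⟨rfl, hproper⟩)
      obtain ⟨-, b, hb, hba⟩ := hmem
      exact ⟨b, by rwa [hD'K j C hC], hQ.symm _ _ _ _ hba⟩
    · rw [hD'D j hj]
      exact hD.arc i j a ha.1
  · by_cases hi : ∃ C, K i C
    · obtain ⟨C, hC⟩ := hi
      rw [hD'K i C hC]
      exact (hKgood i C hC).2.2.2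
    · rw [hD'D i hi]
      exact hD.ideal i

theorem exists_minimal_reduction [Finite X] [Finite Ω] (h : IsJonssonChain n d)
    (hQ : IsAbsorbingNetwork d S Q) (hD : IsAbsorbingReduction d S Q D) :
    ∃ D', IsAbsorbingReduction d S Q D' ∧
      ∀ i, ∀ C ⊆ D' i, C.Nonempty → IsCoordIdeal d S i C → C = D' i := by
  obtain ⟨D', hD', hmin⟩ := wellFounded_lt.has_min {D | IsAbsorbingReduction d S Q D} ⟨D, hD⟩
  refine ⟨D', hD', fun i C hC hne hid => ?_⟩
  by_contra hCD
  obtain ⟨D'', hlt, hD''⟩ := IsAbsorbingReduction.exists_smaller h hQ hD' hC hne hid hCD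
  exact hmin D'' hD'' hlt

end Reduction

/-! ### Collapsing a minimal reduction by polynomials -/

section Collapse

variable {X Ω : Type*} {n : ℕ} {d : ℕ → Ω → Ω → Ω → Ω} {S : Set (X → Ω)}
  {Q : X → X → Ω → Ω → Prop} {D : X → Set Ω}

/-- Families of unary polynomials that map every coordinate ideal into itself. -/
inductive IsIdealPolynomial (d : ℕ → Ω → Ω → Ω → Ω) (S : Set (X → Ω)) : (X → Ω → Ω) → Prop
  | id : IsIdealPolynomial d S fun _ a => a
  | absorb (t φ ψ f) : f ∈ S → IsIdealPolynomial d S φ → IsIdealPolynomial d S ψ →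
      IsIdealPolynomial d S fun i a => d t (φ i a) (f i) (ψ i a)
  | op (t φ χ ψ) : IsIdealPolynomial d S φ → IsIdealPolynomial d S χ → IsIdealPolynomial d S ψ →
      IsIdealPolynomial d S fun i a => d t (φ i a) (χ i a) (ψ i a)

namespace IsIdealPolynomial

theorem comp {φ ψ : X → Ω → Ω} (hφ : IsIdealPolynomial d S φ) (hψ : IsIdealPolynomial d S ψ) :
    IsIdealPolynomial d S fun i a => φ i (ψ i a) := by
  induction hφ with
  | id => exact hψ
  | absorb t _ _ f hf _ _ ih₁ ih₂ => exact absorb t _ _ f hf ih₁ ih₂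
  | op t _ _ _ _ _ _ ih₁ ih₂ ih₃ => exact op t _ _ _ ih₁ ih₂ ih₃

theorem mem {φ : X → Ω → Ω} (hφ : IsIdealPolynomial d S φ) {i : X} {C : Set Ω}
    (hC : IsCoordIdeal d S i C) (hCS : ∀ a ∈ C, ∃ s ∈ S, s i = a) {a : Ω} (ha : a ∈ C) :
    φ i a ∈ C := by
  induction hφ with
  | id => exact ha
  | absorb t _ _ f hf _ _ ih₁ ih₂ => exact hC t _ ih₁ f hf _ ih₂
  | op t _ _ _ _ _ _ ih₁ ih₂ ih₃ =>
    obtain ⟨s, hs, hsi⟩ := hCS _ ih₂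
    have := hC t _ ih₁ s hs _ ih₃
    rwa [hsi] at this

theorem exists_solution {φ : X → Ω → Ω} (hφ : IsIdealPolynomial d S φ)
    (hS : ∀ s, ∀ f ∈ S, ∀ g ∈ S, ∀ h ∈ S, (fun i => d s (f i) (g i) (h i)) ∈ S)
    {s : X → Ω} (hs : s ∈ S) : (fun i => φ i (s i)) ∈ S := by
  induction hφ with
  | id => exact hs
  | absorb t _ _ f hf _ _ ih₁ ih₂ => exact hS t _ ih₁ f hf _ ih₂
  | op t _ _ _ _ _ _ ih₁ ih₂ ih₃ => exact hS t _ ih₁ _ ih₂ _ ih₃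

end IsIdealPolynomial

/-- The pairs `(ψ i y, ψ i y')` form a relation on `D`, subdirect because each orbit of a point is
an ideal and `D` is minimal. A loop of this relation is the required collapse. -/
theorem exists_collapse [Finite Ω] (h : IsJonssonChain n d) {i : X} {D : Set Ω}
    (hD : IsCoordIdeal d S i D) (hDS : ∀ a ∈ D, ∃ s ∈ S, s i = a)
    (hmin : ∀ C ⊆ D, C.Nonempty → IsCoordIdeal d S i C → C = D)
    {y y' : Ω} (hy : y ∈ D) (hy' : y' ∈ D) :
    ∃ ψ, IsIdealPolynomial d S ψ ∧ ψ i y = ψ i y' := by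
  have hfull : ∀ y ∈ D, {a | ∃ ψ, IsIdealPolynomial d S ψ ∧ ψ i y = a} = D := by
    intro y hy
    refine hmin _ ?_ ⟨y, _, .id, rfl⟩ ?_
    · rintro _ ⟨ψ, hψ, rfl⟩
      exact hψ.mem hD hDS hy
    · rintro s _ ⟨φ, hφ, rfl⟩ f hf _ ⟨ψ, hψ, rfl⟩
      exact ⟨_, .absorb s _ _ f hf hφ hψ, rfl⟩
  suffices ∃ c, ∃ ψ, IsIdealPolynomial d S ψ ∧ ψ i y = c ∧ ψ i y' = c by
    obtain ⟨c, ψ, hψ, h₁, h₂⟩ := this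
    exact ⟨ψ, hψ, h₁.trans h₂.symm⟩
  refine exists_loop h D
    (fun a b => ∃ ψ, IsIdealPolynomial d S ψ ∧ ψ i y = a ∧ ψ i y' = b) ⟨y, hy⟩ ?_ ?_ ?_ ?_ ?_
  · rintro _ _ ⟨ψ, hψ, rfl, rfl⟩
    exact ⟨hψ.mem hD hDS hy, hψ.mem hD hDS hy'⟩
  · intro a ha
    rw [← hfull y hy] at ha
    obtain ⟨ψ, hψ, rfl⟩ := ha
    exact ⟨_, ψ, hψ, rfl, rfl⟩
  · intro a ha
    rw [← hfull y' hy'] at ha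
    obtain ⟨ψ, hψ, rfl⟩ := ha
    exact ⟨_, ψ, hψ, rfl, rfl⟩
  · rintro s _ _ _ _ _ _ ⟨φ, hφ, rfl, rfl⟩ ⟨χ, hχ, rfl, rfl⟩ ⟨ψ, hψ, rfl, rfl⟩
    exact ⟨_, .op s _ _ _ hφ hχ hψ, rfl, rfl⟩
  · rintro s _ _ _ _ b hb ⟨φ, hφ, rfl, rfl⟩ ⟨ψ, hψ, rfl, rfl⟩
    obtain ⟨f, hf, rfl⟩ := hDS b hb
    exact ⟨_, .absorb s _ _ f hf hφ hψ, rfl, rfl⟩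

theorem IsAbsorbingReduction.exists_selection [Finite X] [Finite Ω] (h : IsJonssonChain n d)
    (hS : ∀ s, ∀ f ∈ S, ∀ g ∈ S, ∀ h ∈ S, (fun i => d s (f i) (g i) (h i)) ∈ S)
    (hQ : IsAbsorbingNetwork d S Q) (hD : IsAbsorbingReduction d S Q D)
    (hmin : ∀ i, ∀ C ⊆ D i, C.Nonempty → IsCoordIdeal d S i C → C = D i) :
    ∃ r : X → Ω, (∀ i, r i ∈ D i) ∧ ∀ i j, ∃ s ∈ S, s i = r i ∧ s j = r j := by
  classical
  have := Fintype.ofFinite X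
  have hDS : ∀ i, ∀ a ∈ D i, ∃ s ∈ S, s i = a := fun i a ha => by
    obtain ⟨s, hs, h, -⟩ := hQ.solution _ _ _ _ (hD.sub i a ha)
    exact ⟨s, hs, h⟩
  -- Non-constancy on some `D i` would allow a further collapse there. Images at other coordinates
  -- cannot grow under composition.
  obtain ⟨φ, hφ, hφmin⟩ := exists_minimalFor_of_wellFoundedLT (IsIdealPolynomial d S)
    (fun φ => ∑ i, (φ i '' D i).ncard) ⟨_, .id⟩
  have hconst : ∀ i, ∀ a ∈ D i, ∀ b ∈ D i, φ i a = φ i b := by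
    intro i a ha b hb
    by_contra hab
    obtain ⟨ψ, hψ, hψi⟩ := exists_collapse h (hD.ideal i) (hDS i) (hmin i)
      (hφ.mem (hD.ideal i) (hDS i) ha) (hφ.mem (hD.ideal i) (hDS i) hb)
    have himg : ∀ j, (fun a => ψ j (φ j a)) '' D j = ψ j '' (φ j '' D j) := fun j =>
      (Set.image_image _ _ _).symm
    have hlt : ∑ j, ((fun a => ψ j (φ j a)) '' D j).ncard < ∑ j, (φ j '' D j).ncard := by
      refine Finset.sum_lt_sum (fun j _ => ?_) ⟨i, Finset.mem_univ _, ?_⟩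
      · rw [himg]
        exact Set.ncard_image_le (Set.toFinite _)
      · rw [himg]
        refine lt_of_le_of_ne (Set.ncard_image_le (Set.toFinite _)) fun heq => hab ?_
        exact Set.injOn_of_ncard_image_eq heq (Set.toFinite _) ⟨a, ha, rfl⟩ ⟨b, hb, rfl⟩ hψi
    exact absurd (hφmin (hψ.comp hφ) hlt.le) (not_le.2 hlt)
  choose a ha using hD.nonempty
  refine ⟨fun i => φ i (a i), fun i => hφ.mem (hD.ideal i) (hDS i) (ha i), fun i j => ?_⟩
  obtain ⟨b, hb, hab⟩ := hD.arc i j _ (ha i)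
  obtain ⟨s, hs, hsi, hsj⟩ := hQ.solution _ _ _ _ hab
  refine ⟨_, hφ.exists_solution hS hs, congrArg _ hsi, ?_⟩
  exact (congrArg _ hsj).trans (hconst j _ hb _ (ha j))

end Collapse

/-! ### From local satisfiability to pairwise compatible selections -/

/-- Locally satisfiable absorbing constraints on a family closed under a Jónsson chain admit a
selection that is compatible on all pairs of coordinates. -/
theorem exists_pairwise_selection (Ω : Type u) [Finite Ω] [Nonempty Ω] (n : ℕ) :
    ∃ N, ∀ d : ℕ → Ω → Ω → Ω → Ω, IsJonssonChain n d → ∀ {X : Type v} [Finite X]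
      (S : Set (X → Ω)) (E : X → Set Ω),
      (∀ s, ∀ f ∈ S, ∀ g ∈ S, ∀ h ∈ S, (fun i => d s (f i) (g i) (h i)) ∈ S) →
      (∀ i s, ∀ a ∈ E i, ∀ b, ∀ c ∈ E i, d s a b c ∈ E i) →
      (∀ F : List X, F.length ≤ N → ∃ s ∈ S, ∀ q ∈ F, s q ∈ E q) →
      ∃ r : X → Ω, (∀ i, r i ∈ E i) ∧ ∀ i j, ∃ s ∈ S, s i = r i ∧ s j = r j := by
  obtain ⟨N, hN⟩ := exists_arc_consistent.{u, v} (Ω × Ω × Ω) n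
  refine ⟨N * 3, fun d h X _ S E hS hE hsat => ?_⟩
  let triple (s : X → Ω) : X × X × X → Ω × Ω × Ω := fun p => (s p.1, s p.2.1, s p.2.2)
  obtain ⟨P, hne, hPE, -, harc, hid⟩ := hN _ (h.prod (h.prod h)) (triple '' S)
    (fun p => {a | a.1 ∈ E p.1 ∧ a.2.1 ∈ E p.2.1 ∧ a.2.2 ∈ E p.2.2})
    (by
      rintro s _ ⟨f, hf, rfl⟩ _ ⟨g, hg, rfl⟩ _ ⟨k, hk, rfl⟩
      exact ⟨_, hS s f hf g hg k hk, rfl⟩)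
    (by
      rintro p s a ⟨h₁, h₂, h₃⟩ b c ⟨h₁', h₂', h₃'⟩
      exact ⟨hE _ _ _ h₁ _ _ h₁', hE _ _ _ h₂ _ _ h₂', hE _ _ _ h₃ _ _ h₃'⟩)
    (by
      intro F hF
      obtain ⟨s, hs, hsE⟩ := hsat (F.flatMap fun p => [p.1, p.2.1, p.2.2]) (by
        rw [List.length_flatMap]
        simpa using hF)
      refine ⟨_, ⟨s, hs, rfl⟩, fun p hp => ?_⟩
      have hp' : ∀ q ∈ [p.1, p.2.1, p.2.2], s q ∈ E q := fun q hq =>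
        hsE q (List.mem_flatMap.2 ⟨p, hp, hq⟩)
      exact ⟨hp' _ (by simp), hp' _ (by simp), hp' _ (by simp)⟩)
  have hext : ∀ i j l a b c, (a, b, c) ∈ P (i, j, l) → ∀ i' j' l', ∃ s ∈ S, s i = a ∧ s j = b ∧
      s l = c ∧ (s i', s j', s l') ∈ P (i', j', l') := by
    intro i j l a b c habc i' j' l'
    obtain ⟨_, hb, _, ⟨s, hs, rfl⟩, h₁, rfl⟩ := harc (i, j, l) (i', j', l') _ habc
    obtain ⟨h₁, h₂, h₃⟩ : s i = a ∧ s j = b ∧ s l = c := by simpa [triple] using h₁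
    exact ⟨s, hs, h₁, h₂, h₃, hb⟩
  -- Pairs are triples with repeated last coordinate; extending a pair to a genuine triple and
  -- restricting again is path consistency.
  let Q : X → X → Ω → Ω → Prop := fun i j a b => (a, b, b) ∈ P (i, j, j)
  have hQ : IsAbsorbingNetwork d S Q := by
    refine ⟨fun i j a b hab => ?_, fun i j a b hab l => ?_, fun i j a b hab => ?_,
      fun i j s a a' c c' f hf haa hcc => ?_⟩
    · obtain ⟨s, -, rfl, rfl, -, h⟩ := hext _ _ _ _ _ _ hab j i i
      exact h
    · obtain ⟨s, -, rfl, rfl, -, h⟩ := hext _ _ _ _ _ _ hab i l j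
      obtain ⟨s₁, -, h₁, h₂, -, h₃⟩ := hext _ _ _ _ _ _ h i l l
      obtain ⟨s₂, -, -, h₄, h₅, h₆⟩ := hext _ _ _ _ _ _ h l j j
      rw [h₁, h₂] at h₃
      rw [h₄, h₅] at h₆
      exact ⟨s l, h₃, h₆⟩
    · obtain ⟨s, hs, h₁, h₂, -⟩ := hext _ _ _ _ _ _ hab i i i
      exact ⟨s, hs, h₁, h₂⟩
    · exact hid (i, j, j) s _ haa (triple f) ⟨f, hf, rfl⟩ _ hcc
  have hD : IsAbsorbingReduction d S Q fun i => {a | Q i i a a} := by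
    refine ⟨fun i => ?_, fun i a ha => ha, fun i j a ha => ?_, fun i s a ha f hf c hc => ?_⟩
    · obtain ⟨⟨a, b, c⟩, habc⟩ := hne (i, i, i)
      obtain ⟨s, -, -, -, -, h⟩ := hext _ _ _ _ _ _ habc i i i
      exact ⟨s i, h⟩
    · obtain ⟨s, -, rfl, -, -, h⟩ := hext _ _ _ _ _ _ ha i j j
      obtain ⟨s', -, -, h₁, -, h₂⟩ := hext _ _ _ _ _ _ h j j j
      rw [h₁] at h₂
      exact ⟨s j, h₂, h⟩
    · exact hQ.absorb _ _ _ _ _ _ _ f hf ha hc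
  obtain ⟨D, hD', hmin⟩ := exists_minimal_reduction h hQ hD
  obtain ⟨r, hr, hrr⟩ := hD'.exists_selection h hS hQ hmin
  exact ⟨r, fun i => (hPE (i, i, i) (hD'.sub i _ (hr i))).1, hrr⟩

/-! ### The two implications for algebras -/

namespace FirstOrder.Language

variable {L : Language.{u, v}} {A : Type w} [L.Structure A]

theorem Substructure.IsAbsorbing.isJonssonAbsorbing {B : L.Substructure A} (h : B.IsAbsorbing) :
    B.IsJonssonAbsorbing := by
  obtain ⟨N, hN, t, hid, hB⟩ := h
  -- The variable `N - m` receives `y`. At `m = 0` all variables receive `x`, and only at `m = N +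
  -- 1` do all receive `z`.
  refine ⟨N + 1, fun m => t.relabel fun i : Fin N =>
    if (i : ℕ) + m < N then 0 else if (i : ℕ) + m = N then 1 else 2, ?_, ?_, ?_, ?_⟩
  · intro m b a b' hb hb'
    rw [Term.realize_relabel]
    obtain ⟨i, hi⟩ : ∃ i : Fin N, ∀ j : Fin N, j ≠ i → (j : ℕ) + m ≠ N := by
      by_cases hm : 1 ≤ (m : ℕ)
      · refine ⟨⟨N - m, by omega⟩, fun j hj h' => hj (Fin.ext ?_)⟩
        show (j : ℕ) = N - m
        omega
      · exact ⟨⟨0, hN⟩, fun j _ => by omega⟩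
    refine hB i _ fun j hj => ?_
    have := hi j hj
    by_cases h₁ : (j : ℕ) + m < N <;> simp [h₁, this, hb, hb']
  · intro m x y
    rw [Term.realize_relabel, Term.realize_relabel]
    congr 1
    funext i
    simp only [Function.comp_apply, Fin.val_castSucc, Fin.val_succ]
    rcases lt_trichotomy ((i : ℕ) + m) N with h₁ | h₁ | h₁
    · by_cases h₂ : (i : ℕ) + (m + 1) < N
      · simp [h₁, h₂]
      · simp [h₁, show (i : ℕ) + (m + 1) = N by omega]
    · simp [h₁, show ¬ (i : ℕ) + (m + 1) < N by omega, show ¬ (i : ℕ) + (m + 1) = N by omega]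
    · simp [h₁.ne', h₁.not_gt, show ¬ (i : ℕ) + (m + 1) < N by omega,
        show ¬ (i : ℕ) + (m + 1) = N by omega]
  · intro x y z
    rw [Term.realize_relabel]
    refine Eq.trans ?_ (hid x)
    congr 1
    funext i
    simp
  · intro x y z
    rw [Term.realize_relabel]
    refine Eq.trans ?_ (hid z)
    congr 1
    funext i
    simp [show ¬ (i : ℕ) + (N + 1) < N by omega, show ¬ (i : ℕ) + (N + 1) = N by omega]

theorem IsTermOperation.subst {n m : ℕ} {t : L.Term (Fin m)} {f : Fin m → (Fin n → A) → A}
    (hf : ∀ i, L.IsTermOperation (f i)) :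
    L.IsTermOperation fun x => t.realize fun i => f i x := by
  choose s hs using hf
  exact ⟨t.subst s, fun x => by rw [Term.realize_subst]; congr 1; funext i; exact hs i x⟩

theorem isTermOperation_proj {n : ℕ} (i : Fin n) :
    L.IsTermOperation fun x : Fin n → A => x i := ⟨Term.var i, fun _ => rfl⟩

/-- A chain of Jónsson absorption yields operations that agree with idempotent terms on any `k`
points and absorb. -/
theorem Substructure.IsJonssonAbsorbing.exists_local_absorption [Finite A] [Nonempty A]
    {B : L.Substructure A} (h : B.IsJonssonAbsorbing) (k : ℕ) :
    ∃ (N : ℕ) (_ : 1 ≤ N) (r : (Fin N → A) → A),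
      (∀ x : Fin (k + 1) → Fin N → A, ∃ f : (Fin N → A) → A, L.IsTermOperation f ∧
        (∀ a, f (fun _ => a) = a) ∧ ∀ j, f (x j) = r (x j)) ∧
      ∀ (i : Fin N) (x : Fin N → A), (∀ j, j ≠ i → x j ∈ B) → r x ∈ B := by
  classical
  obtain ⟨n, t, htB, htstep, ht0, htn⟩ := h
  let d : ℕ → A → A → A → A := fun s x y z =>
    if hs : s < n + 1 then (t ⟨s, hs⟩).realize ![x, y, z] else z
  have hd : IsJonssonChain n d := by
    have hlast : ∀ s, n ≤ s → ∀ x y z, d s x y z = z := by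
      intro s hs x y z
      by_cases hs' : s < n + 1
      · obtain rfl : s = n := by omega
        simp only [d, hs', dif_pos]
        exact htn x y z
      · simp only [d, hs', dif_neg, not_false_eq_true]
    refine ⟨fun x y z => ?_, hlast, fun s x y => ?_⟩
    · simp only [d, Nat.succ_pos, dif_pos]
      exact ht0 x y z
    · by_cases hs : s < n
      · simp only [d, show s < n + 1 by omega, show s + 1 < n + 1 by omega, dif_pos]
        exact htstep ⟨s, hs⟩ x y
      · rw [hlast s (by omega), hlast (s + 1) (by omega)]
  have hdB : ∀ s, ∀ b ∈ B, ∀ a, ∀ b' ∈ B, d s b a b' ∈ B := by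
    intro s b hb a b' hb'
    by_cases hs : s < n + 1
    · simp only [d, hs, dif_pos]
      exact htB _ _ _ _ hb hb'
    · simpa only [d, hs, dif_neg, not_false_eq_true] using hb'
  obtain ⟨N₀, hN₀⟩ := exists_pairwise_selection.{w, w} (Fin (k + 1) → A) n
  -- One coordinate more than the points occurring in `N₀` tuples of length `k + 1`, so some
  -- coordinate is exceptional for none of them.
  let N := N₀ * (k + 1) + 1
  have hdT : ∀ s (f g h : (Fin N → A) → A), L.IsTermOperation f → L.IsTermOperation g →
      L.IsTermOperation h → L.IsTermOperation fun x => d s (f x) (g x) (h x) := by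
    intro s f g h hf hg hh
    by_cases hs : s < n + 1
    · simp only [d, hs, dif_pos]
      have := IsTermOperation.subst (t := t ⟨s, hs⟩) (f := ![f, g, h]) (by
        intro i
        fin_cases i
        exacts [hf, hg, hh])
      convert this using 3 with x
      funext i
      fin_cases i <;> rfl
    · simpa only [d, hs, dif_neg, not_false_eq_true] using hh
  let S : Set ((Fin (k + 1) → Fin N → A) → Fin (k + 1) → A) :=
    {s | ∃ f : (Fin N → A) → A, L.IsTermOperation f ∧ (∀ a, f (fun _ => a) = a) ∧
      s = fun x j => f (x j)}
  let small : Set (Fin N → A) := {x | ∃ i, ∀ j, j ≠ i → x j ∈ B}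
  obtain ⟨r, hrE, hrS⟩ := hN₀ _ (hd.pi (Fin (k + 1))) S
    (fun x => {a | ∀ j, x j ∈ small → a j ∈ B})
    (by
      rintro s _ ⟨f, hf, hf', rfl⟩ _ ⟨g, hg, hg', rfl⟩ _ ⟨h, hh, hh', rfl⟩
      exact ⟨_, hdT s f g h hf hg hh, fun a => by rw [hf', hg', hh', hd.idem], rfl⟩)
    (fun x s a ha b c hc j hj => hdB s _ (ha j hj) _ _ (hc j hj))
    (by
      intro F hF
      have hsmall : ∀ x : Fin N → A, ∃ i, x ∈ small → ∀ j, j ≠ i → x j ∈ B := by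
        intro x
        by_cases hx : x ∈ small
        · exact hx.imp fun i hi _ => hi
        · exact ⟨0, fun h => absurd h hx⟩
      choose e he using hsmall
      obtain ⟨i, hi⟩ : ∃ i, i ∉ (F.flatMap fun x => List.ofFn fun j => e (x j)).toFinset := by
        by_contra hall
        push Not at hall
        have h₁ := List.toFinset_card_le (F.flatMap fun x => List.ofFn fun j => e (x j))
        rw [Finset.eq_univ_iff_forall.2 hall, Finset.card_univ, Fintype.card_fin,
          List.length_flatMap] at h₁
        have h₂ := Nat.mul_le_mul_right (k + 1) hF
        simp at h₁
        omega
      refine ⟨_, ⟨_, isTermOperation_proj i, fun _ => rfl, rfl⟩, fun x hx j hj => ?_⟩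
      refine he _ hj _ fun h' => hi ?_
      rw [List.mem_toFinset, List.mem_flatMap]
      exact ⟨x, hx, List.mem_ofFn.2 ⟨j, h'.symm⟩⟩)
  -- The value at a point is read off its constant tuple; using `k + 1` entries ensures that index
  -- `0` exists. Compatibility of a tuple with the constant tuple of each entry makes this agree
  -- with the selection on the whole tuple.
  refine ⟨N, Nat.succ_pos _, fun x => r (fun _ => x) 0, fun x => ?_, fun i x hx =>
    hrE (fun _ => x) 0 ⟨i, hx⟩⟩
  have hagree : ∀ (x y : Fin (k + 1) → Fin N → A), ∃ f : (Fin N → A) → A, L.IsTermOperation f ∧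
      (∀ a, f (fun _ => a) = a) ∧ (∀ j, f (x j) = r x j) ∧ ∀ j, f (y j) = r y j := by
    intro x y
    obtain ⟨_, ⟨f, hf, hf', rfl⟩, h₁, h₂⟩ := hrS x y
    exact ⟨f, hf, hf', congrFun h₁, congrFun h₂⟩
  obtain ⟨f, hf, hf', hfx, -⟩ := hagree x x
  refine ⟨f, hf, hf', fun j => ?_⟩
  obtain ⟨g, -, -, hg₁, hg₂⟩ := hagree x fun _ => x j
  exact (hfx j).trans ((hg₁ j).symm.trans (hg₂ 0))

theorem Substructure.IsJonssonAbsorbing.isAbsorbing [Finite A] (hA : L.IsFinitelyRelated A)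
    {B : L.Substructure A} (h : B.IsJonssonAbsorbing) : B.IsAbsorbing := by
  rcases isEmpty_or_nonempty A with hempty | hne
  · exact ⟨1, le_rfl, Term.var 0, fun a => isEmptyElim a, fun _ x => isEmptyElim (x 0)⟩
  obtain ⟨R, _, hfin, _, hR⟩ := hA
  obtain ⟨k, hk⟩ := (Set.finite_range (Sigma.fst : (Σ k, R.Relations k) → ℕ)).bddAbove
  obtain ⟨N, hN, r, hr, hrB⟩ := h.exists_local_absorption k
  obtain ⟨t, ht⟩ := (hR N hN r).2 (by
    intro l ρ m hm
    have hl : l ≤ k := hk ⟨⟨l, ρ⟩, rfl⟩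
    -- Relations of smaller arity are padded with arbitrary points.
    obtain ⟨f, hf, -, hfr⟩ := hr fun i j =>
      if hi : (i : ℕ) < l then m j ⟨i, hi⟩ else Classical.arbitrary A
    have := (hR N hN f).1 hf l ρ m hm
    convert this using 2 with i
    have := hfr ⟨i, by omega⟩
    simpa using this.symm)
  refine ⟨N, hN, t, fun a => ?_, fun i x hx => ?_⟩
  · rw [ht]
    obtain ⟨f, -, hf, hfr⟩ := hr fun _ _ => a
    rw [← hfr 0, hf]
  · rw [ht]
    exact hrB i x hx

end FirstOrder.Language

theorem theorem1 (L : FirstOrder.Language.{u, v}) [L.IsAlgebraic] (A : Type w)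
    [L.Structure A] [Finite A]
    (hA : L.IsFinitelyRelated A) (B : L.Substructure A) :
    B.IsAbsorbing ↔ B.IsJonssonAbsorbing :=
  ⟨fun h => h.isJonssonAbsorbing, fun h => h.isAbsorbing hA⟩
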